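/- Let $\mathsf{Nat}$ be the category with objects $n=\{0,\dots,n-1\}$ for $n\in\mathbb N$ and with the strictly increasing functions as morphisms, and let $\mathsf{LO}$ be the category of linear orders and order embeddings. A \emph{Goodstein dilator} is a functor $D:\mathsf{Nat}\to\mathsf{LO}$ such that (a) each order $D(n)$ is equal to an initial segment of $\mathbb N$ with the usual order, (b) $D$ preserves pullbacks, and (c) $0\in D(0)$, and $D(\mathrm{emp}_n)(0)=0$ for the empty function $\mathrm{emp}_n:0\to n$ and every $n$. In second order arithmetic, $D$ is coded by a set of natural numbers. Let $\operatorname{supp}_n:D(n)\to[n]^{<\omega}$ be the (unique) natural transformation from $D$ to the finite powerset functor such that $\operatorname{supp}_n(\sigma)\subseteq\operatorname{rng}(f)$ implies $\sigma\in\operatorname{rng}(D(f))$ for all morphisms $f:m\to n$ and all $\sigma\in D(n)$. For a linear order $X$, let $\overline D(X)$ be the set of pairs $(a,\sigma)$ of a finite set $a\subseteq X$ and an element $\sigma\in D(|a|)$ with $\operatorname{supp}_{|a|}(\sigma)=\{0,\dots,|a|-1\}$, ordered by $$(a,\sigma)<(b,\tau)\quad\Leftrightarrow\quad D(|\iota_a|)(\sigma)<D(|\iota_b|)(\tau)\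 \text{ in } D(|a\cup b|),$$ where $|\iota_a|:|a|\to|a\cup b|$ and $|\iota_b|:|b|\to|a\cup b|$ are the morphisms of $\mathsf{Nat}$ that correspond to the inclusions $a\hookrightarrow a\cup b$ and $b\hookrightarrow a\cup b$ under the increasing enumerations of these finite sets. For a non-decreasing function $b:\mathbb N\to\mathbb N$ with $b(0)>0$ and for $m\in D(b(0))$, define the Goodstein sequence (without coefficient changes) by $G^D_{b,m}(0)=m$, and $G^D_{b,m}(i+1)=0$ if $G^D_{b,m}(i)=0$, and $G^D_{b,m}(i+1)=D(c_i)(G^D_{b,m}(i))-1$ otherwise, where $c_i:b(i)\to b(i+1)$ is the inclusion $c_i(n)=n$. \textbf{Theorem.} The theory $\mathbf{RCA}_0$ proves (equivalently, it holds in every model of $\mathbf{RCA}_0$) that the following are equivalent for any Goodstein dilator $D$: \begin{enumerate} \item[(i)] for any non-decreasing function $b:\mathbb N\to\mathbb N$ with $b(0)>0$ and any $m\in D(b(0))$, there is an $i\in\mathbb N$ with $G^D_{b,m}(i)=0$; \item[(ii)] the linear order $\overline D(\mathbb N)$ is well founded (i.e. it contains no infinite descending sequence). \end{enumerate} -/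

import Mathlib

universe u

namespace SOA

/-! ### The language of second order arithmetic and the theory `RCA₀`

A structure for the two-sorted language of second order arithmetic consists of a first order part
`N` with `0, 1, +, *, <`, and of a family `S : Set (Set N)` of subsets of `N`, which is the range
of the set quantifiers (general, i.e. Henkin, semantics; `N` may be nonstandard).
`RCA₀` proves a sentence if and only if the sentence holds in every model of `RCA₀`
(completeness theorem).
All notions defined below are relative to such a structure, and they only quantify over elements
of `N` and over members of `S`. -/

/-- The first order part of a structure for the language of second order arithmetic
(the axioms are stated in `ModelsRCA0`). -/
class NumStr (N : Type u) extends Zero N, One N, Add N, Mul N, LT N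

/-- Number terms; `var i` is a de Bruijn index. -/
inductive NumTerm : Type
  | var (i : ℕ) : NumTerm
  | zero : NumTerm
  | one : NumTerm
  | add (s t : NumTerm) : NumTerm
  | mul (s t : NumTerm) : NumTerm

/-- Bounded (`Σ⁰₀`) formulas with number and set variables. In `ball t φ`, i.e. `∀ x < t, φ`, the
variable `x` has index `0` in `φ`, and the indices of the other number variables are shifted
(so that `x` does not occur in `t`). -/
inductive BddFormula : Type
  | eq (s t : NumTerm) : BddFormula
  | lt (s t : NumTerm) : BddFormula
  | mem (t : NumTerm) (X : ℕ) : BddFormula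
  | neg (φ : BddFormula) : BddFormula
  | and (φ ψ : BddFormula) : BddFormula
  | ball (t : NumTerm) (φ : BddFormula) : BddFormula

section

variable {N : Type u} [NumStr N]

/-- Put the value `x` in front of a variable assignment. -/
def push (x : N) (e : ℕ → N) : ℕ → N
  | 0 => x
  | i + 1 => e i

def NumTerm.val (e : ℕ → N) : NumTerm → N
  | .var i => e i
  | .zero => 0
  | .one => 1
  | .add s t => s.val e + t.val e
  | .mul s t => s.val e * t.val e

/-- Satisfaction of bounded formulas, for values `e i` of the number variables and values `E i` of
the set variables. -/
def BddFormula.Holds (E : ℕ → Set N) : BddFormula → (ℕ → N) → Prop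
  | .eq s t, e => s.val e = t.val e
  | .lt s t, e => s.val e < t.val e
  | .mem t X, e => t.val e ∈ E X
  | .neg φ, e => ¬ φ.Holds E e
  | .and φ ψ, e => φ.Holds E e ∧ ψ.Holds E e
  | .ball t φ, e => ∀ x : N, x < t.val e → φ.Holds E (push x e)

/-- The `Σ⁰₁` formula `∃ y, φ(y, n)` with parameters `e` and `E`. -/
def SigmaOne (φ : BddFormula) (E : ℕ → Set N) (e : ℕ → N) (n : N) : Prop :=
  ∃ y : N, φ.Holds E (push y (push n e))

/-- The `Π⁰₁` formula `∀ y, φ(y, n)` with parameters `e` and `E`. -/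
def PiOne (φ : BddFormula) (E : ℕ → Set N) (e : ℕ → N) (n : N) : Prop :=
  ∀ y : N, φ.Holds E (push y (push n e))

/-- `(N, S)` is a model of `RCA₀`: the basic axioms, induction for `Σ⁰₁` formulas and comprehension
for `Δ⁰₁` formulas (with number and set parameters). -/
structure ModelsRCA0 (S : Set (Set N)) : Prop where
  /-- the range of the set variables is nonempty -/
  nonempty : S.Nonempty
  succ_ne_zero : ∀ n : N, n + 1 ≠ 0
  succ_inj : ∀ m n : N, m + 1 = n + 1 → m = n
  add_zero : ∀ m : N, m + 0 = m
  add_succ : ∀ m n : N, m + (n + 1) = (m + n) + 1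
  mul_zero : ∀ m : N, m * 0 = 0
  mul_succ : ∀ m n : N, m * (n + 1) = m * n + m
  not_lt_zero : ∀ m : N, ¬ m < 0
  lt_succ : ∀ m n : N, m < n + 1 ↔ (m < n ∨ m = n)
  sigmaOne_induction : ∀ (φ : BddFormula) (E : ℕ → Set N) (e : ℕ → N), (∀ i, E i ∈ S) →
    SigmaOne φ E e 0 → (∀ n : N, SigmaOne φ E e n → SigmaOne φ E e (n + 1)) →
    ∀ n : N, SigmaOne φ E e n
  deltaOne_comprehension : ∀ (φ ψ : BddFormula) (E : ℕ → Set N) (e : ℕ → N), (∀ i, E i ∈ S) →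
    (∀ n : N, SigmaOne φ E e n ↔ PiOne ψ E e n) →
    ∃ X ∈ S, ∀ n : N, n ∈ X ↔ SigmaOne φ E e n

/-! ### Coding of pairs, finite sets, functions -/

/-- The code of an ordered pair. -/
def pair (x y : N) : N := (x + y) * (x + y) + x

/-- `t` has the form `(k, (m, n))`. -/
def IsTriple (t : N) : Prop := ∃ k m n : N, t = pair k (pair m n)

/-- The triple `(k, (m, n))` represents the finite set of all `i < k` such that `m(i+1)+1`
divides `n`. The relation `FinMem i t` says that `i` lies in the finite set represented by `t`. -/
def FinMem (i t : N) : Prop :=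
  ∃ k m n : N, t = pair k (pair m n) ∧ i < k ∧ ∃ q : N, n = (m * (i + 1) + 1) * q

/-- `t` is the code of a finite set, i.e. the least triple that represents it. -/
def IsFinSet (t : N) : Prop :=
  IsTriple t ∧ ∀ t' : N, t' < t → IsTriple t' → ¬ ∀ i : N, FinMem i t' ↔ FinMem i t

/-- `s` codes a finite sequence of length `c`, i.e. a function with domain `{0,…,c-1}`, as the
finite set of pairs that constitutes its graph. -/
def IsFinSeq (c s : N) : Prop :=
  IsFinSet s ∧ (∀ z : N, FinMem z s → ∃ i j : N, z = pair i j ∧ i < c) ∧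
    ∀ i : N, i < c → ∃! j : N, FinMem (pair i j) s

/-- The set `F` is (the graph of) a function from the numbers to the numbers. -/
def IsFun (F : Set N) : Prop :=
  (∀ z ∈ F, ∃ x y : N, z = pair x y) ∧ ∀ x : N, ∃! y : N, pair x y ∈ F

/-! ### Linear orders and embeddings -/

/-- `r` is a strict linear order with underlying set `A`. -/
def IsLinOrd (A : N → Prop) (r : N → N → Prop) : Prop :=
  (∀ x y, r x y → A x ∧ A y) ∧ (∀ x, ¬ r x x) ∧ (∀ x y z, r x y → r y z → r x z) ∧
    ∀ x y, A x → A y → r x y ∨ x = y ∨ r y x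

/-- The set `G` is (the graph of) an order embedding of `(A, r)` into `(B, r')`. -/
def IsEmb (A : N → Prop) (r : N → N → Prop) (B : N → Prop) (r' : N → N → Prop) (G : Set N) :
    Prop :=
  (∀ z ∈ G, ∃ x y : N, z = pair x y ∧ A x ∧ B y) ∧ (∀ x, A x → ∃! y : N, pair x y ∈ G) ∧
    ∀ x x' y y' : N, pair x y ∈ G → pair x' y' ∈ G → r x x' → r' y y'

/-- A set `L` codes a linear order via its elements `(0, x)` for `x` in the order and
`(1, (x, y))` for `x` smaller than `y`. -/
def OrdMem (L : Set N) (x : N) : Prop := pair 0 x ∈ L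

def OrdLt (L : Set N) (x y : N) : Prop := pair 1 (pair x y) ∈ L

/-! ### The category of natural numbers -/

/-- `f` codes a morphism `m → n` in the category of natural numbers, i.e. a strictly increasing
function from `{0,…,m-1}` to `{0,…,n-1}`, as `f = (m, (n, s))` where `s` codes its graph. -/
def IsMor (m n f : N) : Prop :=
  ∃ s : N, f = pair m (pair n s) ∧ IsFinSeq m s ∧
    (∀ i j : N, FinMem (pair i j) s → j < n) ∧
    ∀ i i' j j' : N, FinMem (pair i j) s → FinMem (pair i' j') s → i < i' → j < j'

/-- `f(i) = j`, for the code `f` of a morphism. -/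
def App (f i j : N) : Prop := ∃ m n s : N, f = pair m (pair n s) ∧ FinMem (pair i j) s

/-- `f` is an identity or, more generally, an inclusion: `f(i) = i` for all arguments `i`. -/
def IsIncl (f : N) : Prop := ∀ i j : N, App f i j → j = i

/-- `h = g ∘ f`, for codes of morphisms `f : l → m`, `g : m → n`, `h : l → n`. -/
def IsComp (f g h : N) : Prop := ∀ i j k : N, App f i j → App g j k → App h i k

/-- The morphisms `p : l → m`, `p' : l → m'`, `e : m → n`, `e' : m' → n` form a pullback square
in the category of natural numbers. -/
def IsNatPullback (l m m' n p p' e e' : N) : Prop :=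
  IsMor l m p ∧ IsMor l m' p' ∧ IsMor m n e ∧ IsMor m' n e' ∧
  (∃ d : N, IsMor l n d ∧ IsComp p e d ∧ IsComp p' e' d) ∧
  ∀ k j j' : N, IsMor k m j → IsMor k m' j' →
    (∃ d : N, IsMor k n d ∧ IsComp j e d ∧ IsComp j' e' d) →
    ∃! h : N, IsMor k l h ∧ IsComp h p j ∧ IsComp h p' j'

/-! ### Functors from natural numbers to linear orders, Goodstein dilators

A functor `D` is coded by a set with elements `(0, (n, σ))` for `σ ∈ D(n)`, `(1, (n, (σ, τ)))` for
`σ < τ` in `D(n)`, and `(2, (f, (σ, τ)))` for `D(f)(σ) = τ`. -/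

/-- `σ ∈ D(n)` -/
def ObjMem (D : Set N) (n σ : N) : Prop := pair 0 (pair n σ) ∈ D

/-- `σ < τ` in `D(n)` -/
def ObjLt (D : Set N) (n σ τ : N) : Prop := pair 1 (pair n (pair σ τ)) ∈ D

/-- `D(f)(σ) = τ` -/
def MapTo (D : Set N) (f σ τ : N) : Prop := pair (1 + 1) (pair f (pair σ τ)) ∈ D

/-- `D` codes a functor from the category of natural numbers to the category of linear orders. -/
structure IsFunctor (D : Set N) : Prop where
  linOrd : ∀ n : N, IsLinOrd (ObjMem D n) (ObjLt D n)
  map_mem : ∀ m n f σ τ : N, IsMor m n f → MapTo D f σ τ → ObjMem D m σ ∧ ObjMem D n τ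
  map_total : ∀ m n f σ : N, IsMor m n f → ObjMem D m σ → ∃! τ : N, MapTo D f σ τ
  map_lt : ∀ m n f σ σ' τ τ' : N, IsMor m n f → MapTo D f σ τ → MapTo D f σ' τ' →
    ObjLt D m σ σ' → ObjLt D n τ τ'
  map_id : ∀ n f σ : N, IsMor n n f → IsIncl f → ObjMem D n σ → MapTo D f σ σ
  map_comp : ∀ l m n f g h σ τ ρ : N, IsMor l m f → IsMor m n g → IsMor l n h → IsComp f g h →
    MapTo D f σ τ → MapTo D g τ ρ → MapTo D h σ ρ

/-- `D(e) ∘ G = D(e') ∘ G'`, for functions `G` and `G'` with the same domain. -/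
def AgreeAfter (D : Set N) (e e' : N) (G G' : Set N) : Prop :=
  ∀ x y y' τ : N, pair x y ∈ G → pair x y' ∈ G' → (MapTo D e y τ ↔ MapTo D e' y' τ)

/-- `D(p) ∘ H = G`, for functions `H` and `G` with the same domain. -/
def FactorsAs (D : Set N) (p : N) (H G : Set N) : Prop :=
  ∀ x y z : N, pair x y ∈ H → pair x z ∈ G → MapTo D p y z

/-- The images of `p : l → m`, `p' : l → m'`, `e : m → n`, `e' : m' → n` under the functor `D` have
the universal property of a pullback square in the category of linear orders. (The image of a
commutative square commutes by functoriality.) -/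
def IsOrdPullback (S : Set (Set N)) (D : Set N) (l m m' p p' e e' : N) : Prop :=
  ∀ L ∈ S, IsLinOrd (OrdMem L) (OrdLt L) →
    ∀ G ∈ S, ∀ G' ∈ S,
      IsEmb (OrdMem L) (OrdLt L) (ObjMem D m) (ObjLt D m) G →
      IsEmb (OrdMem L) (OrdLt L) (ObjMem D m') (ObjLt D m') G' →
      AgreeAfter D e e' G G' →
      ∃! H : Set N, H ∈ S ∧ IsEmb (OrdMem L) (OrdLt L) (ObjMem D l) (ObjLt D l) H ∧
        FactorsAs D p H G ∧ FactorsAs D p' H G'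

/-- `D` codes a Goodstein dilator. -/
structure IsGoodsteinDilator (S : Set (Set N)) (D : Set N) : Prop where
  isFunctor : IsFunctor D
  /-- the underlying set of each `D(n)` is an initial segment of the natural numbers … -/
  initial : ∀ n σ τ : N, ObjMem D n σ → τ < σ → ObjMem D n τ
  /-- … with the usual order -/
  usual_order : ∀ n σ τ : N, ObjMem D n σ → ObjMem D n τ → (ObjLt D n σ τ ↔ σ < τ)
  preserves_pullbacks : ∀ l m m' n p p' e e' : N, IsNatPullback l m m' n p p' e e' →
    IsOrdPullback S D l m m' p p' e e'
  zero_mem : ObjMem D 0 0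
  /-- the empty morphism `0 → b` maps zero to zero -/
  map_zero : ∀ b f : N, IsMor 0 b f → MapTo D f 0 0

/-! ### Supports and the extension of a Goodstein dilator to linear orders -/

/-- `supp_n(σ) = a`, where a family of functions `supp_n` from `D(n)` to the finite subsets of
`{0,…,n-1}` is coded by the set `U` of all `(n, (σ, a))` with `supp_n(σ) = a`. -/
def SuppTo (U : Set N) (n σ a : N) : Prop := pair n (pair σ a) ∈ U

/-- `U` codes a natural transformation from `D` to the finite powerset functor such that
`supp_n(σ) ⊆ rng(f)` implies `σ ∈ rng(D(f))`. -/
structure IsSupport (D U : Set N) : Prop where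
  total : ∀ n σ : N, ObjMem D n σ → ∃! a : N, SuppTo U n σ a
  finSubset : ∀ n σ a : N, ObjMem D n σ → SuppTo U n σ a →
    IsFinSet a ∧ ∀ i : N, FinMem i a → i < n
  natural : ∀ m n f σ τ a a' : N, IsMor m n f → MapTo D f σ τ → SuppTo U m σ a → SuppTo U n τ a' →
    ∀ j : N, FinMem j a' ↔ ∃ i : N, FinMem i a ∧ App f i j
  range : ∀ m n f σ a : N, IsMor m n f → ObjMem D n σ → SuppTo U n σ a →
    (∀ j : N, FinMem j a → ∃ i : N, App f i j) → ∃ ρ : N, MapTo D f ρ σ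

/-- `s` codes the increasing enumeration `{0,…,c-1} ≅ a` of the finite set `a`, with respect to the
order `r`; in particular `c` is the cardinality of `a`. -/
def IsEnum (r : N → N → Prop) (a c s : N) : Prop :=
  IsFinSet a ∧ IsFinSeq c s ∧ (∀ x : N, FinMem x a ↔ ∃ i : N, FinMem (pair i x) s) ∧
    ∀ i i' x x' : N, FinMem (pair i x) s → FinMem (pair i' x') s → i < i' → r x x'

/-- `c = |a|` -/
def IsCard (r : N → N → Prop) (a c : N) : Prop := ∃ s : N, IsEnum r a c s

/-- `f = |ι| : |a| → |b|`, where `ι` is the inclusion of a finite set `a` into a finite set `b`. -/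
def IsInclMor (r : N → N → Prop) (a b f : N) : Prop :=
  ∃ c d s t : N, IsEnum r a c s ∧ IsEnum r b d t ∧ IsMor c d f ∧
    ∀ i j x : N, App f i j → FinMem (pair i x) s → FinMem (pair j x) t

/-- `u = a ∪ b` for codes of finite sets. -/
def IsUnion (a b u : N) : Prop := IsFinSet u ∧ ∀ x : N, FinMem x u ↔ FinMem x a ∨ FinMem x b

/-- Underlying set of the extension of `D` at the linear order `(A, r)`: the set of pairs `(a, σ)`
of a finite `a ⊆ A` and a `σ ∈ D(|a|)` with `supp_{|a|}(σ) = {0,…,|a|-1}`. -/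
def ExtMem (D U : Set N) (A : N → Prop) (r : N → N → Prop) (z : N) : Prop :=
  ∃ a σ c w : N, z = pair a σ ∧ IsFinSet a ∧ (∀ x : N, FinMem x a → A x) ∧ IsCard r a c ∧
    ObjMem D c σ ∧ SuppTo U c σ w ∧ ∀ i : N, FinMem i w ↔ i < c

/-- Order relation on the extension of `D` at a linear order with order relation `r`:
`(a, σ) < (b, τ)` if and only if `D(|ι|)(σ) < D(|ι'|)(τ)` holds in `D(|a ∪ b|)`, for the inclusions
`ι : a → a ∪ b` and `ι' : b → a ∪ b`. -/
def ExtLt (D : Set N) (r : N → N → Prop) (z z' : N) : Prop :=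
  ∃ a σ b τ u d f g σ' τ' : N, z = pair a σ ∧ z' = pair b τ ∧ IsUnion a b u ∧ IsCard r u d ∧
    IsInclMor r a u f ∧ IsInclMor r b u g ∧ MapTo D f σ σ' ∧ MapTo D g τ τ' ∧ ObjLt D d σ' τ'

/-- The order relation `r` on `A` is well founded: there is no infinite descending sequence. -/
def IsWellFounded (S : Set (Set N)) (A : N → Prop) (r : N → N → Prop) : Prop :=
  ¬ ∃ F ∈ S, IsFun F ∧ (∀ i z : N, pair i z ∈ F → A z) ∧
    ∀ i z z' : N, pair i z ∈ F → pair (i + 1) z' ∈ F → r z' z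

/-- The extension of `D`, formed with the (unique) support functions of `D`, has a well founded
value on the order `ℕ` of all natural numbers (of the structure). -/
def ExtNatWellFounded (S : Set (Set N)) (D : Set N) : Prop :=
  ∃ U ∈ S, IsSupport D U ∧
    IsWellFounded S (ExtMem D U (fun _ => True) (fun x y => x < y)) (ExtLt D (fun x y => x < y))

/-! ### Goodstein sequences without coefficient changes -/

/-- `B` is (the graph of) a non-decreasing function `b` from numbers to numbers with `b(0) > 0`. -/
def IsBase (B : Set N) : Prop :=
  IsFun B ∧ (∀ i j x y : N, i < j → pair i x ∈ B → pair j y ∈ B → (x < y ∨ x = y)) ∧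
    ∀ x : N, pair 0 x ∈ B → 0 < x

/-- `G` is the Goodstein sequence for `D`, the base change `B` and the start value `k`: we have
`G(0) = k`, and `G(i+1)` is `0` if `G(i) = 0` and `D(c)(G(i)) - 1` otherwise, where `c` is the
inclusion of `{0,…,b(i)-1}` into `{0,…,b(i+1)-1}`. -/
def IsGoodsteinSeq (D B : Set N) (k : N) (G : Set N) : Prop :=
  IsFun G ∧ pair 0 k ∈ G ∧ ∀ i x y : N, pair i x ∈ G → pair (i + 1) y ∈ G →
    (x = 0 → y = 0) ∧
    (x ≠ 0 → ∃ u v c τ : N, pair i u ∈ B ∧ pair (i + 1) v ∈ B ∧ IsMor u v c ∧ IsIncl c ∧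
      MapTo D c x τ ∧ τ = y + 1)

/-- For any base change `b` and any `k ∈ D(b(0))`, the Goodstein sequence reaches zero. -/
def GoodsteinTerminates (S : Set (Set N)) (D : Set N) : Prop :=
  ∀ B ∈ S, IsBase B → ∀ u k : N, pair 0 u ∈ B → ObjMem D u k →
    ∃ G ∈ S, IsGoodsteinSeq D B k G ∧ ∃ i : N, pair i 0 ∈ G

end

end SOA

universe v w

namespace SOA

/-! Everything takes place inside a fixed model, whose numbers may be nonstandard. The core is a
translation between values in the sets `D(n)` and their normal forms `(a, ρ)`, where `a` is a finite
set of numbers and the value is obtained from `ρ` by applying `D` to the inclusion of `a` into `n`.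
By `extLt_iff`, two normal forms may be compared in any `D(n)` with both finite sets below `n`: the
inclusions factor through the union, and `D` of an increasing map is strictly monotone.

Well foundedness gives termination: suppose a Goodstein sequence `g` never vanishes, and take the
normal form of each `g(i)` in `D(b(i))`. Enlarging the base does not change a normal form, but it
turns `g(i)` into `D(c_i)(g(i)) = g(i+1) + 1`. Compared in `D(b(i+1))`, the normal forms therefore
descend.

Termination gives well foundedness: from a descending sequence of pairs `(a_i, σ_i)`, choose a
non-decreasing `b` with all elements of `a_i` below `b(i)`, and let `e(i)` in `D(b(i))` be the value
with normal form `(a_i, σ_i)`. Descent means `e(i+1) < D(c_i)(e(i))`. The Goodstein sequence that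
starts at `e(0)` drops by only one at each step, so it satisfies `e(i) ≤ g(i)` throughout. No `e(i)`
is zero, because `D(c_i)(0) = 0` has nothing below it. Hence `g` never reaches zero.

This direction must also produce support functions. A point `i` belongs to the support of `σ` if `σ`
is not in the range of `D` applied to the enumeration of `{0,…,n-1}` without `i`; preservation of
pullbacks (`exists_mapTo_of_inter`) allows all the avoidable points to be removed together
(`exists_mapTo_of_supp`). The bound `le_of_mapTo` on preimages makes this definition computable.

The remaining work is to carry this out in `RCA₀`. `Def` says that the graph of a function is a set
of the model; its closure properties replace explicit formulas. Unbounded search is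
`exists_def_least`, finite sets are coded by divisibility through coprime moduli (`exists_triple`),
and these yield primitive recursion (`exists_recursion`). -/

/-- A model of `RCA₀`, bundled with the range of its set quantifiers. -/
class Model (N : Type u) extends NumStr N where
  sets : Set (Set N)
  models : ModelsRCA0 sets

/-! ### Basic arithmetic -/

namespace Model

section Arithmetic

variable {N : Type u} [Model N]

theorem exists_mem_sets (N : Type u) [Model N] : ∃ A : Set N, A ∈ sets (N := N) :=
  (models (N := N)).nonempty

/-- Induction for predicates that are given by a bounded formula. -/
theorem bdd_induction {P : N → Prop} (φ : BddFormula) (e : ℕ → N) (E : ℕ → Set N)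
    (hE : ∀ i, E i ∈ sets (N := N))
    (h : ∀ n y, φ.Holds E (push y (push n e)) ↔ P n) (h0 : P 0)
    (hs : ∀ n, P n → P (n + 1)) (n : N) : P n := by
  -- The truth of `φ` does not depend on the witness `y`, so the existential quantifier is idle.
  have key : ∀ n, SigmaOne φ E e n ↔ P n := fun n => by simp [SigmaOne, h]
  have := (models (N := N)).sigmaOne_induction φ E e hE
  simp only [key] at this
  exact this h0 hs n

/-- Induction for predicates that are given by a `Σ⁰₁` formula. -/
theorem exists_induction {P : N → N → Prop} (φ : BddFormula) (e : ℕ → N) (E : ℕ → Set N)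
    (hE : ∀ i, E i ∈ sets (N := N))
    (h : ∀ n y, φ.Holds E (push y (push n e)) ↔ P n y) (h0 : ∃ y, P 0 y)
    (hs : ∀ n, (∃ y, P n y) → ∃ y, P (n + 1) y) (n : N) : ∃ y, P n y := by
  have key : ∀ n, SigmaOne φ E e n ↔ ∃ y, P n y := fun n => by simp [SigmaOne, h]
  have := (models (N := N)).sigmaOne_induction φ E e hE
  simp only [key] at this
  exact this h0 hs n

/-- Induction for equations between terms, with parameters `a` and `b`. -/
theorem eq_induction (s t : NumTerm) (a b : N)
    (h0 : s.val (push 0 (push 0 (push a fun _ => b))) = t.val (push 0 (push 0 (push a fun _ => b))))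
    (hs : ∀ n : N, s.val (push 0 (push n (push a fun _ => b))) =
      t.val (push 0 (push n (push a fun _ => b))) →
      s.val (push 0 (push (n + 1) (push a fun _ => b))) =
        t.val (push 0 (push (n + 1) (push a fun _ => b))))
    (hst : ∀ n y : N, s.val (push y (push n (push a fun _ => b))) =
      t.val (push y (push n (push a fun _ => b))) ↔
      s.val (push 0 (push n (push a fun _ => b))) = t.val (push 0 (push n (push a fun _ => b))))
    (n : N) :
    s.val (push 0 (push n (push a fun _ => b))) = t.val (push 0 (push n (push a fun _ => b))) := by
  obtain ⟨A, hA⟩ := exists_mem_sets N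
  exact bdd_induction
    (P := fun n => s.val (push 0 (push n (push a fun _ => b))) =
      t.val (push 0 (push n (push a fun _ => b))))
    (.eq s t) (push a fun _ => b) (fun _ => A) (fun _ => hA) hst h0 hs n

protected theorem add_zero (a : N) : a + 0 = a := models.add_zero a

protected theorem add_succ (a b : N) : a + (b + 1) = a + b + 1 := models.add_succ a b

protected theorem mul_zero (a : N) : a * 0 = 0 := models.mul_zero a

protected theorem mul_succ (a b : N) : a * (b + 1) = a * b + a := models.mul_succ a b

/-- In these terms `.var 0` is the idle witness, `.var 1` the induction variable, and parameters
start at `.var 2`. -/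
protected theorem zero_add (n : N) : 0 + n = n :=
  eq_induction (.add .zero (.var 1)) (.var 1) (0 : N) 0 (Model.add_zero _)
    (fun n (h : 0 + n = n) => show 0 + (n + 1) = n + 1 by rw [Model.add_succ, h])
    (fun _ _ => Iff.rfl) n

protected theorem succ_add (m n : N) : m + 1 + n = m + n + 1 :=
  eq_induction (.add (.add (.var 2) .one) (.var 1)) (.add (.add (.var 2) (.var 1)) .one) m 0
    (show m + 1 + 0 = m + 0 + 1 by simp only [Model.add_zero])
    (fun n (h : m + 1 + n = m + n + 1) => show m + 1 + (n + 1) = m + (n + 1) + 1 by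
      rw [Model.add_succ, h, Model.add_succ])
    (fun _ _ => Iff.rfl) n

protected theorem add_comm (m n : N) : m + n = n + m :=
  eq_induction (.add (.var 2) (.var 1)) (.add (.var 1) (.var 2)) m 0
    (show m + 0 = 0 + m by rw [Model.add_zero, Model.zero_add])
    (fun n (h : m + n = n + m) => show m + (n + 1) = n + 1 + m by
      rw [Model.add_succ, h, Model.succ_add])
    (fun _ _ => Iff.rfl) n

protected theorem add_assoc (a b n : N) : a + b + n = a + (b + n) :=
  eq_induction (.add (.add (.var 2) (.var 3)) (.var 1)) (.add (.var 2) (.add (.var 3) (.var 1))) a b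
    (show a + b + 0 = a + (b + 0) by simp only [Model.add_zero])
    (fun n (h : a + b + n = a + (b + n)) => show a + b + (n + 1) = a + (b + (n + 1)) by
      rw [Model.add_succ, h, Model.add_succ, Model.add_succ])
    (fun _ _ => Iff.rfl) n

instance instAddCommMonoid : AddCommMonoid N where
  add_assoc := Model.add_assoc
  zero_add := Model.zero_add
  add_zero := Model.add_zero
  add_comm := Model.add_comm
  nsmul := nsmulRec

protected theorem zero_mul (n : N) : 0 * n = 0 :=
  eq_induction (.mul .zero (.var 1)) .zero (0 : N) 0 (Model.mul_zero _)
    (fun n (h : 0 * n = 0) => show 0 * (n + 1) = 0 by rw [Model.mul_succ, h, add_zero])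
    (fun _ _ => Iff.rfl) n

protected theorem succ_mul (m n : N) : (m + 1) * n = m * n + n :=
  eq_induction (.mul (.add (.var 2) .one) (.var 1)) (.add (.mul (.var 2) (.var 1)) (.var 1)) m 0
    (show (m + 1) * 0 = m * 0 + 0 by simp only [Model.add_zero, Model.mul_zero])
    (fun n (h : (m + 1) * n = m * n + n) => show (m + 1) * (n + 1) = m * (n + 1) + (n + 1) by
      rw [Model.mul_succ, h, Model.mul_succ]; ac_rfl)
    (fun _ _ => Iff.rfl) n

protected theorem mul_comm (m n : N) : m * n = n * m :=
  eq_induction (.mul (.var 2) (.var 1)) (.mul (.var 1) (.var 2)) m 0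
    (show m * 0 = 0 * m by rw [Model.mul_zero, Model.zero_mul])
    (fun n (h : m * n = n * m) => show m * (n + 1) = (n + 1) * m by
      rw [Model.mul_succ, h, Model.succ_mul])
    (fun _ _ => Iff.rfl) n

protected theorem mul_add (a b n : N) : a * (b + n) = a * b + a * n :=
  eq_induction (.mul (.var 2) (.add (.var 3) (.var 1)))
    (.add (.mul (.var 2) (.var 3)) (.mul (.var 2) (.var 1))) a b
    (show a * (b + 0) = a * b + a * 0 by simp only [Model.add_zero, Model.mul_zero])
    (fun n (h : a * (b + n) = a * b + a * n) =>
      show a * (b + (n + 1)) = a * b + a * (n + 1) by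
        rw [Model.add_succ, Model.mul_succ, h, Model.mul_succ, add_assoc])
    (fun _ _ => Iff.rfl) n

protected theorem mul_assoc (a b n : N) : a * b * n = a * (b * n) :=
  eq_induction (.mul (.mul (.var 2) (.var 3)) (.var 1)) (.mul (.var 2) (.mul (.var 3) (.var 1))) a b
    (show a * b * 0 = a * (b * 0) by simp only [Model.mul_zero])
    (fun n (h : a * b * n = a * (b * n)) => show a * b * (n + 1) = a * (b * (n + 1)) by
      rw [Model.mul_succ, h, Model.mul_succ, Model.mul_add])
    (fun _ _ => Iff.rfl) n

protected theorem mul_one (a : N) : a * 1 = a := by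
  rw [← zero_add (1 : N), Model.mul_succ, Model.mul_zero, zero_add]

instance instCommSemiring : CommSemiring N where
  zero_mul := Model.zero_mul
  mul_zero := Model.mul_zero
  mul_assoc := Model.mul_assoc
  one_mul a := by rw [Model.mul_comm, Model.mul_one]
  mul_one := Model.mul_one
  left_distrib := Model.mul_add
  right_distrib a b c := by rw [Model.mul_comm, Model.mul_add, Model.mul_comm c a, Model.mul_comm c b]
  mul_comm := Model.mul_comm
  nsmul := nsmulRec

/-- The predecessor is the witness of a `Σ⁰₁` induction whose step ignores the induction hypothesis.
The disjunction is written with negation and conjunction, the available connectives. -/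
theorem eq_zero_or_succ (n : N) : n = 0 ∨ ∃ m, n = m + 1 := by
  obtain ⟨A, hA⟩ := exists_mem_sets N
  obtain ⟨y, hy⟩ := exists_induction (P := fun n y : N => ¬ (n ≠ 0 ∧ n ≠ y + 1))
    (.neg (.and (.neg (.eq (.var 1) .zero)) (.neg (.eq (.var 1) (.add (.var 0) .one)))))
    (fun _ => 0) (fun _ => A) (fun _ => hA) (fun _ _ => Iff.rfl) ⟨0, by simp⟩
    (fun n _ => ⟨n, by simp⟩) n
  by_cases h : n = 0
  · exact .inl h
  · exact .inr ⟨y, by_contra fun h' => hy ⟨h, h'⟩⟩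

theorem succ_injective {m n : N} (h : m + 1 = n + 1) : m = n := models.succ_inj m n h

protected theorem add_left_cancel (a b c : N) (h : a + b = a + c) : b = c := by
  obtain ⟨A, hA⟩ := exists_mem_sets N
  have key := bdd_induction (P := fun a : N => ¬ (a + b = a + c ∧ b ≠ c))
    (.neg (.and (.eq (.add (.var 1) (.var 2)) (.add (.var 1) (.var 3)))
      (.neg (.eq (.var 2) (.var 3)))))
    (push b fun _ => c) (fun _ => A) (fun _ => hA) (fun _ _ => Iff.rfl)
    (by simp) (fun n hn => by
      rintro ⟨h1, h2⟩
      rw [Model.succ_add, Model.succ_add] at h1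
      exact hn ⟨succ_injective h1, h2⟩) a
  exact by_contra fun h' => key ⟨h, h'⟩

/-! ### The order and its compatibility with the arithmetic operations -/

protected theorem lt_succ {m n : N} : m < n + 1 ↔ m < n ∨ m = n := models.lt_succ m n

protected theorem lt_add (a z : N) : a < a + (z + 1) := by
  obtain ⟨A, hA⟩ := exists_mem_sets N
  refine bdd_induction (P := fun z : N => a < a + (z + 1))
    (.lt (.var 2) (.add (.var 2) (.add (.var 1) .one))) (push a fun _ => 0) (fun _ => A)
    (fun _ => hA) (fun _ _ => Iff.rfl) ?_ ?_ z
  · simp [Model.lt_succ]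
  · intro n hn
    rw [Model.add_succ, Model.lt_succ]
    exact .inl hn

/-- The difference is found by `Σ⁰₁` induction on the larger number. This reduces the order to
addition, so that later inequalities become polynomial identities. -/
protected theorem lt_iff {a b : N} : a < b ↔ ∃ z, b = a + (z + 1) := by
  refine ⟨fun h => ?_, fun ⟨z, hz⟩ => hz ▸ Model.lt_add a z⟩
  obtain ⟨A, hA⟩ := exists_mem_sets N
  obtain ⟨y, hy⟩ := exists_induction (P := fun n y : N => ¬ (a < n ∧ n ≠ a + (y + 1)))
    (.neg (.and (.lt (.var 2) (.var 1))
      (.neg (.eq (.var 1) (.add (.var 2) (.add (.var 0) .one))))))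
    (push a fun _ => 0) (fun _ => A) (fun _ => hA) (fun _ _ => Iff.rfl)
    ⟨0, fun h => models.not_lt_zero _ h.1⟩
    (fun n ⟨y, hy⟩ => by
      by_cases h1 : a < n
      · refine ⟨y + 1, fun h => h.2 ?_⟩
        have : n = a + (y + 1) := by_contra fun h' => hy ⟨h1, h'⟩
        rw [this, add_assoc]
      · refine ⟨0, fun h => h.2 ?_⟩
        have := (Model.lt_succ.1 h.1).resolve_left h1
        rw [this, zero_add]) b
  exact ⟨y, by_contra fun h' => hy ⟨h, h'⟩⟩

protected theorem trichotomy (a b : N) : a < b ∨ a = b ∨ b < a := by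
  obtain ⟨A, hA⟩ := exists_mem_sets N
  have := bdd_induction (P := fun n : N => ¬ (¬ a < n ∧ a ≠ n ∧ ¬ n < a))
    (.neg (.and (.neg (.lt (.var 2) (.var 1))) (.and (.neg (.eq (.var 2) (.var 1)))
      (.neg (.lt (.var 1) (.var 2)))))) (push a fun _ => 0) (fun _ => A)
    (fun _ => hA) (fun _ _ => Iff.rfl) (by
      rintro ⟨-, h1, h2⟩
      obtain rfl | ⟨m, rfl⟩ := eq_zero_or_succ a
      · exact h1 rfl
      · exact h2 (Model.lt_iff.2 ⟨m, by rw [zero_add]⟩)) (fun n hn => by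
      rintro ⟨h1, h2, h3⟩
      rw [Model.lt_succ, not_or] at h1
      refine hn ⟨h1.1, h1.2, fun h => ?_⟩
      obtain ⟨z, rfl⟩ := Model.lt_iff.1 h
      obtain rfl | ⟨z, rfl⟩ := eq_zero_or_succ z
      · exact h2 (by rw [zero_add])
      · exact h3 (Model.lt_iff.2 ⟨z, by ac_rfl⟩)) b
  tauto

protected theorem lt_irrefl (a : N) : ¬ a < a := by
  intro h
  obtain ⟨z, hz⟩ := Model.lt_iff.1 h
  exact models.succ_ne_zero z (Model.add_left_cancel a _ _ (by rw [← hz, add_zero]))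

protected theorem lt_trans {a b c : N} (h : a < b) (h' : b < c) : a < c := by
  obtain ⟨y, rfl⟩ := Model.lt_iff.1 h
  obtain ⟨z, rfl⟩ := Model.lt_iff.1 h'
  exact Model.lt_iff.2 ⟨y + 1 + z, by ac_rfl⟩

noncomputable instance instLinearOrder : LinearOrder N where
  le a b := a < b ∨ a = b
  lt a b := a < b
  le_refl a := .inr rfl
  le_trans a b c := by
    rintro (h | rfl) (h' | rfl)
    exacts [.inl (Model.lt_trans h h'), .inl h, .inl h', .inr rfl]
  le_antisymm a b := by
    rintro (h | rfl) (h' | h')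
    exacts [(Model.lt_irrefl _ (Model.lt_trans h h')).elim, h'.symm, rfl, rfl]
  le_total a b := by
    rcases Model.trichotomy a b with h | h | h
    exacts [.inl (.inl h), .inl (.inr h), .inr (.inl h)]
  lt_iff_le_not_ge a b := by
    refine ⟨fun h => ⟨.inl h, ?_⟩, ?_⟩
    · rintro (h' | rfl)
      exacts [Model.lt_irrefl _ (Model.lt_trans h h'), Model.lt_irrefl _ h]
    · rintro ⟨h | rfl, h'⟩
      exacts [h, (h' (.inr rfl)).elim]
  toDecidableLE := Classical.decRel _

protected theorem le_iff {a b : N} : a ≤ b ↔ ∃ z, b = a + z := by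
  constructor
  · rintro (h | rfl)
    · obtain ⟨z, hz⟩ := Model.lt_iff.1 h
      exact ⟨_, hz⟩
    · exact ⟨0, by simp⟩
  · rintro ⟨z, rfl⟩
    obtain rfl | ⟨z, rfl⟩ := eq_zero_or_succ z
    · exact .inr (by simp)
    · exact .inl (Model.lt_add a z)

instance instCanonicallyOrderedAdd : CanonicallyOrderedAdd N where
  exists_add_of_le h := Model.le_iff.1 h
  le_add_self _ b := Model.le_iff.2 ⟨b, add_comm _ _⟩
  le_self_add _ b := Model.le_iff.2 ⟨b, rfl⟩

instance instIsStrictOrderedRing : IsStrictOrderedRing N where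
  add_le_add_left a b h c := by
    obtain ⟨z, rfl⟩ := Model.le_iff.1 h
    exact Model.le_iff.2 ⟨z, by ac_rfl⟩
  le_of_add_le_add_left a b c h := by
    obtain ⟨z, hz⟩ := Model.le_iff.1 h
    exact Model.le_iff.2 ⟨z, Model.add_left_cancel a _ _ (by rw [hz, add_assoc])⟩
  zero_le_one := Model.le_iff.2 ⟨1, by simp⟩
  exists_pair_ne := ⟨0, 1, fun h => models.succ_ne_zero (0 : N) (by rw [← h, add_zero])⟩
  mul_lt_mul_of_pos_left a ha b c h := by
    obtain ⟨z, rfl⟩ := Model.lt_iff.1 h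
    obtain ⟨y, rfl⟩ := Model.lt_iff.1 ha
    refine Model.lt_iff.2 ⟨y * z + y + z, ?_⟩
    ring
  mul_lt_mul_of_pos_right a ha b c h := by
    obtain ⟨z, rfl⟩ := Model.lt_iff.1 h
    obtain ⟨y, rfl⟩ := Model.lt_iff.1 ha
    refine Model.lt_iff.2 ⟨y * z + y + z, ?_⟩
    ring

theorem lt_succ_iff {a b : N} : a < b + 1 ↔ a ≤ b := Model.lt_succ

theorem succ_le_iff {a b : N} : a + 1 ≤ b ↔ a < b := by
  rw [← lt_succ_iff, add_lt_add_iff_right]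

theorem pos_iff_exists {n : N} : 0 < n ↔ ∃ m, n = m + 1 := by
  rw [Model.lt_iff]; simp

theorem exists_eq_succ {n : N} (h : n ≠ 0) : ∃ m, n = m + 1 := (eq_zero_or_succ n).resolve_left h

/-! ### Pairs -/

theorem left_le_pair (x y : N) : x ≤ pair x y := le_add_self

theorem right_le_pair (x y : N) : y ≤ pair x y := by
  obtain rfl | ⟨m, rfl⟩ := eq_zero_or_succ y
  · exact zero_le
  · refine Model.le_iff.2 ⟨x * x + (2 * x * (m + 1)) + m * (m + 1) + x, ?_⟩
    unfold pair; ring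

theorem left_lt_pair_succ (x y : N) : x < pair x y + 1 := lt_succ_iff.2 (left_le_pair x y)

theorem right_lt_pair_succ (x y : N) : y < pair x y + 1 := lt_succ_iff.2 (right_le_pair x y)

/-- With `s = x + y`, the code lies between `s²` and `s² + s`, hence below `(s + 1)²`. Codes with
different sums thus lie in disjoint intervals. -/
theorem pair_lt_of_add_lt {x y x' y' : N} (h : x + y < x' + y') : pair x y < pair x' y' := by
  obtain ⟨z, hz⟩ := Model.lt_iff.1 h
  refine lt_of_lt_of_le ?_ (le_self_add : _ ≤ pair x' y')
  rw [hz]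
  refine Model.lt_iff.2 ⟨(x + y) * z + z * (x + y) + x + y + y + z * z + z + z, ?_⟩
  unfold pair; ring

theorem pair_inj {x y x' y' : N} : pair x y = pair x' y' ↔ x = x' ∧ y = y' := by
  refine ⟨fun h => ?_, fun ⟨h, h'⟩ => h ▸ h' ▸ rfl⟩
  have hs : x + y = x' + y' := by
    rcases lt_trichotomy (x + y) (x' + y') with h' | h' | h'
    exacts [absurd h (pair_lt_of_add_lt h').ne, h', absurd h.symm (pair_lt_of_add_lt h').ne]
  unfold pair at h
  rw [hs] at h
  have hx := add_left_cancel h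
  subst hx
  exact ⟨rfl, add_left_cancel hs⟩

end Arithmetic
/-! ### Comprehension -/

namespace Bdd

def or (φ ψ : BddFormula) : BddFormula := .neg (.and (.neg φ) (.neg ψ))

def imp (φ ψ : BddFormula) : BddFormula := .neg (.and φ (.neg ψ))

def bex (t : NumTerm) (φ : BddFormula) : BddFormula := .neg (.ball t (.neg φ))

/-- `φ` holds for some `x ≤ t`. -/
def bexLe (t : NumTerm) (φ : BddFormula) : BddFormula := bex (.add t .one) φ

def pairTerm (s t : NumTerm) : NumTerm := .add (.mul (.add s t) (.add s t)) s

end Bdd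

section Comprehension

variable {N : Type u}

@[simp] theorem push_zero (x : N) (e : ℕ → N) : push x e 0 = x := rfl

@[simp] theorem push_succ (x : N) (e : ℕ → N) (i : ℕ) : push x e (i + 1) = e i := rfl

@[simp] theorem push_one (x : N) (e : ℕ → N) : push x e 1 = e 0 := rfl
@[simp] theorem push_two (x : N) (e : ℕ → N) : push x e 2 = e 1 := rfl
@[simp] theorem push_three (x : N) (e : ℕ → N) : push x e 3 = e 2 := rfl
@[simp] theorem push_four (x : N) (e : ℕ → N) : push x e 4 = e 3 := rfl
@[simp] theorem push_five (x : N) (e : ℕ → N) : push x e 5 = e 4 := rfl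

/-- Three sets, as values of the set variables. -/
def setEnv (A B C : Set N) : ℕ → Set N
  | 0 => A
  | 1 => B
  | _ => C

@[simp] theorem setEnv_zero (A B C : Set N) : setEnv A B C 0 = A := rfl
@[simp] theorem setEnv_one (A B C : Set N) : setEnv A B C 1 = B := rfl
@[simp] theorem setEnv_two (A B C : Set N) : setEnv A B C 2 = C := rfl

variable [Model N]


@[simp] theorem holds_or (E : ℕ → Set N) (φ ψ : BddFormula) (e : ℕ → N) :
    (Bdd.or φ ψ).Holds E e ↔ φ.Holds E e ∨ ψ.Holds E e := by
  simp only [Bdd.or, BddFormula.Holds]; tauto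

@[simp] theorem holds_imp (E : ℕ → Set N) (φ ψ : BddFormula) (e : ℕ → N) :
    (Bdd.imp φ ψ).Holds E e ↔ (φ.Holds E e → ψ.Holds E e) := by
  simp only [Bdd.imp, BddFormula.Holds]; tauto

@[simp] theorem holds_bexLe (E : ℕ → Set N) (t : NumTerm) (φ : BddFormula) (e : ℕ → N) :
    (Bdd.bexLe t φ).Holds E e ↔ ∃ x ≤ t.val e, φ.Holds E (push x e) := by
  simp [Bdd.bexLe, Bdd.bex, BddFormula.Holds, NumTerm.val, lt_succ_iff]

@[simp] theorem val_pairTerm (s t : NumTerm) (e : ℕ → N) :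
    (Bdd.pairTerm s t).val e = pair (s.val e) (t.val e) := rfl

attribute [simp] BddFormula.Holds NumTerm.val

theorem setEnv_mem {A B C : Set N} (hA : A ∈ sets (N := N)) (hB : B ∈ sets (N := N))
    (hC : C ∈ sets (N := N)) : ∀ i, setEnv A B C i ∈ sets (N := N)
  | 0 => hA
  | 1 => hB
  | _ + 2 => hC

/-- Comprehension for a bounded formula with three set parameters and one number parameter. -/
theorem bdd_comprehension {A B C : Set N} (hA : A ∈ sets (N := N)) (hB : B ∈ sets (N := N))
    (hC : C ∈ sets (N := N)) (c : N) (φ : BddFormula) {P : N → Prop}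
    (h : ∀ n y, φ.Holds (setEnv A B C) (push y (push n (fun _ => c))) ↔ P n) :
    {n | P n} ∈ sets (N := N) := by
  -- One formula serves as both the `Σ⁰₁` and the `Π⁰₁` form, since `y` is a dummy.
  obtain ⟨X, hX, hX'⟩ := (models (N := N)).deltaOne_comprehension φ φ (setEnv A B C) (fun _ => c)
    (setEnv_mem hA hB hC) (by simp [SigmaOne, PiOne, h])
  convert hX
  ext n
  simp [hX', SigmaOne, h]

/-- Comprehension for a `Δ⁰₁` formula with three set parameters. -/
theorem delta_comprehension {A B C : Set N} (hA : A ∈ sets (N := N)) (hB : B ∈ sets (N := N))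
    (hC : C ∈ sets (N := N)) (φ ψ : BddFormula) {P Q : N → N → Prop}
    (hφ : ∀ n y, φ.Holds (setEnv A B C) (push y (push n (fun _ => 0))) ↔ P n y)
    (hψ : ∀ n y, ψ.Holds (setEnv A B C) (push y (push n (fun _ => 0))) ↔ Q n y)
    (h : ∀ n, (∃ y, P n y) ↔ ∀ y, Q n y) :
    {n | ∃ y, P n y} ∈ sets (N := N) := by
  obtain ⟨X, hX, hX'⟩ := (models (N := N)).deltaOne_comprehension φ ψ (setEnv A B C) (fun _ => 0)
    (setEnv_mem hA hB hC) (by simp [SigmaOne, PiOne, hφ, hψ, h])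
  convert hX
  ext n
  simp [hX', SigmaOne, hφ]

end Comprehension

/-! ### Computable functions -/

/-- Types whose elements are coded by the elements of a set in the model. -/
class Cod (N : Type u) [Model N] (α : Type v) where
  toNum : α → N
  toNum_injective : Function.Injective toNum
  range_toNum_mem : Set.range toNum ∈ sets (N := N)

section Cod

variable {N : Type u} [Model N] {α : Type v} {β : Type w}

/-- The code of an element. -/
def enc (N : Type u) [Model N] {α : Type v} [Cod N α] (a : α) : N := Cod.toNum a

theorem enc_injective [Cod N α] : Function.Injective (enc N (α := α)) := Cod.toNum_injective

theorem range_enc_mem [Cod N α] : Set.range (enc N (α := α)) ∈ sets (N := N) :=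
  Cod.range_toNum_mem

theorem univ_mem_sets : Set.univ ∈ sets (N := N) := by
  obtain ⟨A, hA⟩ := exists_mem_sets N
  exact bdd_comprehension hA hA hA 0 (.eq .zero .zero) (by simp)

instance : Cod N N where
  toNum := id
  toNum_injective := Function.injective_id
  range_toNum_mem := by simpa using univ_mem_sets

-- Coding truth values by 1 and 0 makes predicates a special case of functions, so that a single
-- notion `Def` covers both.
open Classical in
noncomputable instance : Cod N Prop where
  toNum p := if p then 1 else 0
  toNum_injective p q h := by
    by_cases hp : p <;> by_cases hq : q <;> simp_all
  range_toNum_mem := by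
    convert bdd_comprehension univ_mem_sets univ_mem_sets univ_mem_sets (0 : N)
      (Bdd.or (.eq (.var 1) .one) (.eq (.var 1) .zero)) (P := fun n => n = 1 ∨ n = 0) (by simp)
      using 1
    ext n
    constructor
    · rintro ⟨p, rfl⟩
      by_cases hp : p <;> simp [hp]
    · rintro (rfl | rfl)
      · exact ⟨True, by simp⟩
      · exact ⟨False, by simp⟩

instance [Cod N α] [Cod N β] : Cod N (α × β) where
  toNum p := pair (enc N p.1) (enc N p.2)
  toNum_injective p q h := by
    obtain ⟨h1, h2⟩ := pair_inj.1 h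
    exact Prod.ext (enc_injective h1) (enc_injective h2)
  range_toNum_mem := by
    convert bdd_comprehension (range_enc_mem (N := N) (α := α)) (range_enc_mem (N := N) (α := β))
      univ_mem_sets (0 : N) (Bdd.bexLe (.var 1) (Bdd.bexLe (.var 2) (.and (.and (.mem (.var 1) 0)
        (.mem (.var 0) 1)) (.eq (.var 3) (Bdd.pairTerm (.var 1) (.var 0))))))
      (P := fun n => ∃ x ≤ n, ∃ y ≤ n, (x ∈ Set.range (enc N (α := α)) ∧
        y ∈ Set.range (enc N (α := β))) ∧ n = pair x y) (by simp [-Set.mem_range]) using 1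
    ext n
    constructor
    · rintro ⟨p, rfl⟩
      exact ⟨_, left_le_pair _ _, _, right_le_pair _ _, ⟨⟨_, rfl⟩, ⟨_, rfl⟩⟩, rfl⟩
    · rintro ⟨_, -, _, -, ⟨⟨a, rfl⟩, ⟨b, rfl⟩⟩, rfl⟩
      exact ⟨(a, b), rfl⟩

@[simp] theorem enc_num (x : N) : enc N x = x := rfl

@[simp] theorem enc_prod [Cod N α] [Cod N β] (p : α × β) :
    enc N p = pair (enc N p.1) (enc N p.2) := rfl

@[simp] theorem enc_true : enc N True = 1 := if_pos trivial

@[simp] theorem enc_false : enc N False = 0 := if_neg not_false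

@[simp] theorem enc_inj [Cod N α] {a b : α} : enc N a = enc N b ↔ a = b :=
  enc_injective.eq_iff

end Cod

/-- The graph of a function, as a set of codes. -/
def graph (N : Type u) [Model N] {α : Type v} {β : Type w} [Cod N α] [Cod N β] (f : α → β) :
    Set N :=
  Set.range fun a => pair (enc N a) (enc N (f a))

/-- A function is computable if its graph is a set of the model. -/
@[fun_prop]
def Def (N : Type u) [Model N] {α : Type v} {β : Type w} [Cod N α] [Cod N β] (f : α → β) : Prop :=
  graph N f ∈ sets (N := N)

namespace Def

universe x y

variable {N : Type u} [Model N] {α : Type v} {β : Type w} {γ : Type x} {δ : Type y}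
  [Cod N α] [Cod N β] [Cod N γ] [Cod N δ]

theorem pair_mem_graph {f : α → β} {a : α} {z : N} :
    pair (enc N a) z ∈ graph N f ↔ z = enc N (f a) := by
  simp [graph, pair_inj, eq_comm]

/-- The codes of the elements at which a predicate holds. -/
def codes (N : Type u) [Model N] {α : Type v} [Cod N α] (P : α → Prop) : Set N :=
  enc N '' {a | P a}

@[simp] theorem enc_mem_codes {P : α → Prop} {a : α} : enc N a ∈ codes N P ↔ P a := by
  simp [codes]

local notation "R" => Set.range (enc N (α := α))

theorem rangeMem : R ∈ sets (N := N) := range_enc_mem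

theorem ite_enc_eq {p : Prop} {z : N} : enc N p = z ↔ (p ∧ z = 1) ∨ (¬ p ∧ z = 0) := by
  by_cases hp : p <;> simp [hp, eq_comm]

/-- The codes form the section at 1 of the graph of the characteristic function; conversely, that
graph is recovered by a bounded formula that also mentions the set of all codes of `α`. -/
theorem iff_codes_mem {P : α → Prop} : Def N P ↔ codes N P ∈ sets (N := N) := by
  constructor
  · intro h
    convert bdd_comprehension h h h (0 : N) (.mem (Bdd.pairTerm (.var 1) .one) 0)
      (P := fun n => pair n 1 ∈ graph N P) (by simp [-Set.mem_range]) using 1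
    ext n
    constructor
    · rintro ⟨a, ha, rfl⟩
      have : P a = True := by simpa using ha
      refine ⟨a, ?_⟩
      simp [this]
    · rintro ⟨a, ha⟩
      obtain ⟨rfl, h2⟩ := pair_inj.1 ha
      refine ⟨a, ?_, rfl⟩
      rw [ite_enc_eq] at h2
      exact h2.elim (·.1) (fun h => absurd h.2 one_ne_zero)
  · intro h
    have := bdd_comprehension h (rangeMem (α := α)) h (0 : N) (Bdd.bexLe (.var 1)
      (.and (.mem (.var 0) 1) (Bdd.or (.and (.mem (.var 0) 0) (.eq (.var 2) (Bdd.pairTerm (.var 0) .one)))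
        (.and (.neg (.mem (.var 0) 0)) (.eq (.var 2) (Bdd.pairTerm (.var 0) .zero))))))
      (P := fun n => ∃ x ≤ n, x ∈ R ∧ ((x ∈ codes N P ∧ n = pair x 1) ∨
        (x ∉ codes N P ∧ n = pair x 0))) (by simp [-Set.mem_range])
    change graph N _ ∈ _
    convert this using 1
    ext n
    constructor
    · rintro ⟨a, rfl⟩
      refine ⟨enc N a, left_le_pair _ _, ⟨a, rfl⟩, ?_⟩
      by_cases ha : P a <;> simp [ha]
    · rintro ⟨_, -, ⟨a, rfl⟩, ⟨ha, rfl⟩ | ⟨ha, rfl⟩⟩ <;> rw [enc_mem_codes] at ha <;>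
        exact ⟨a, by simp [ha]⟩

@[fun_prop]
theorem id : Def N fun a : α => a := by
  change graph N _ ∈ _
  convert bdd_comprehension (rangeMem (α := α)) univ_mem_sets univ_mem_sets (0 : N) (Bdd.bexLe (.var 1)
      (.and (.mem (.var 0) 0) (.eq (.var 2) (Bdd.pairTerm (.var 0) (.var 0)))))
      (P := fun n => ∃ x ≤ n, x ∈ R ∧ n = pair x x) (by simp [-Set.mem_range]) using 1
  ext n
  constructor
  · rintro ⟨a, rfl⟩
    exact ⟨_, left_le_pair _ _, ⟨a, rfl⟩, rfl⟩
  · rintro ⟨_, -, ⟨a, rfl⟩, rfl⟩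
    exact ⟨a, rfl⟩

@[fun_prop]
theorem const (b : β) : Def N fun _ : α => b := by
  change graph N _ ∈ _
  convert bdd_comprehension (rangeMem (α := α)) univ_mem_sets univ_mem_sets (enc N b : N) (Bdd.bexLe (.var 1)
      (.and (.mem (.var 0) 0) (.eq (.var 2) (Bdd.pairTerm (.var 0) (.var 3)))))
      (P := fun n => ∃ x ≤ n, x ∈ R ∧ n = pair x (enc N b)) (by simp [-Set.mem_range]) using 1
  ext n
  constructor
  · rintro ⟨a, rfl⟩
    exact ⟨_, left_le_pair _ _, ⟨a, rfl⟩, rfl⟩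
  · rintro ⟨_, -, ⟨a, rfl⟩, rfl⟩
    exact ⟨a, rfl⟩

@[fun_prop]
-- The intermediate value has no bound in terms of the pair of argument and result, so genuine `Δ⁰₁`
-- comprehension is needed: some `y` is the value of `f` and is sent to `z`, or equivalently every
-- `y` that is the value of `f` is sent to `z`.
theorem comp {g : β → γ} {f : α → β} (hg : Def N g) (hf : Def N f) : Def N fun a => g (f a) := by
  have := delta_comprehension (A := R) (rangeMem (α := α)) hf hg
    (Bdd.bexLe (.var 1) (Bdd.bexLe (.var 2) (.and (.eq (.var 3) (Bdd.pairTerm (.var 1) (.var 0)))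
      (.and (.mem (.var 1) 0) (.and (.mem (Bdd.pairTerm (.var 1) (.var 2)) 1)
        (.mem (Bdd.pairTerm (.var 2) (.var 0)) 2))))))
    (Bdd.bexLe (.var 1) (Bdd.bexLe (.var 2) (.and (.eq (.var 3) (Bdd.pairTerm (.var 1) (.var 0)))
      (.and (.mem (.var 1) 0) (Bdd.imp (.mem (Bdd.pairTerm (.var 1) (.var 2)) 1)
        (.mem (Bdd.pairTerm (.var 2) (.var 0)) 2))))))
    (P := fun n y => ∃ x ≤ n, ∃ z ≤ n, n = pair x z ∧ x ∈ R ∧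
      pair x y ∈ graph N f ∧ pair y z ∈ graph N g)
    (Q := fun n y => ∃ x ≤ n, ∃ z ≤ n, n = pair x z ∧ x ∈ R ∧
      (pair x y ∈ graph N f → pair y z ∈ graph N g))
    (by simp [-Set.mem_range]) (by simp [-Set.mem_range]) ?_
  · change graph N _ ∈ _
    convert this using 1
    ext n
    constructor
    · rintro ⟨a, rfl⟩
      exact ⟨enc N (f a), enc N a, left_le_pair _ _, _, right_le_pair _ _, rfl, ⟨a, rfl⟩,
        ⟨a, rfl⟩, ⟨f a, rfl⟩⟩
    · rintro ⟨y, _, -, z, -, rfl, ⟨a, rfl⟩, h1, h2⟩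
      rw [pair_mem_graph] at h1
      subst h1
      rw [pair_mem_graph] at h2
      exact ⟨a, by rw [h2]⟩
  · intro n
    constructor
    · rintro ⟨y, _, hx, z, hz, rfl, ⟨a, rfl⟩, h1, h2⟩ y'
      refine ⟨_, hx, z, hz, rfl, ⟨a, rfl⟩, fun h3 => ?_⟩
      rw [pair_mem_graph] at h1 h3
      rwa [h3, ← h1]
    · intro h
      -- The instance at 0 only serves to decompose `n`; the information comes from the instance at
      -- the actual value of `f`.
      obtain ⟨_, hx, z, hz, rfl, ⟨a, rfl⟩, -⟩ := h 0
      obtain ⟨x', -, z', -, h1, -, h2⟩ := h (enc N (f a))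
      obtain ⟨rfl, rfl⟩ := pair_inj.1 h1
      have h3 : pair (enc N a) (enc N (f a)) ∈ graph N f := ⟨a, rfl⟩
      exact ⟨_, _, hx, z, hz, rfl, ⟨a, rfl⟩, h3, h2 h3⟩

@[fun_prop]
theorem prodMk {f : α → β} {g : α → γ} (hf : Def N f) (hg : Def N g) :
    Def N fun a => (f a, g a) := by
  have := bdd_comprehension (A := R) (rangeMem (α := α)) hf hg 0
    (Bdd.bexLe (.var 1) (Bdd.bexLe (.var 2) (Bdd.bexLe (.var 3) (.and
      (.and (.eq (.var 4) (Bdd.pairTerm (.var 2) (Bdd.pairTerm (.var 1) (.var 0))))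
      (.mem (.var 2) 0)) (.and (.mem (Bdd.pairTerm (.var 2) (.var 1)) 1)
        (.mem (Bdd.pairTerm (.var 2) (.var 0)) 2))))))
    (P := fun n => ∃ x ≤ n, ∃ y ≤ n, ∃ z ≤ n, (n = pair x (pair y z) ∧ x ∈ R) ∧
      pair x y ∈ graph N f ∧ pair x z ∈ graph N g) (by simp [-Set.mem_range])
  change graph N _ ∈ _
  convert this using 1
  ext n
  constructor
  · rintro ⟨a, rfl⟩
    exact ⟨_, left_le_pair _ _, _, (left_le_pair _ _).trans (right_le_pair _ _), _,
      (right_le_pair _ _).trans (right_le_pair _ _), ⟨rfl, ⟨a, rfl⟩⟩, ⟨a, rfl⟩, ⟨a, rfl⟩⟩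
  · rintro ⟨_, -, y, -, z, -, ⟨rfl, ⟨a, rfl⟩⟩, h1, h2⟩
    rw [pair_mem_graph] at h1 h2
    exact ⟨a, by simp [h1, h2]⟩

theorem prodFst : Def N fun p : α × β => p.1 := by
  have := bdd_comprehension (rangeMem (α := α)) (rangeMem (N := N) (α := β)) univ_mem_sets 0
    (Bdd.bexLe (.var 1) (Bdd.bexLe (.var 2) (.and (.and (.mem (.var 1) 0) (.mem (.var 0) 1))
      (.eq (.var 3) (Bdd.pairTerm (Bdd.pairTerm (.var 1) (.var 0)) (.var 1))))))
    (P := fun n => ∃ x ≤ n, ∃ y ≤ n, (x ∈ Set.range (enc N (α := α)) ∧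
        y ∈ Set.range (enc N (α := β))) ∧ n = pair (pair x y) x) (by simp [-Set.mem_range])
  change graph N _ ∈ _
  convert this using 1
  ext n
  constructor
  · rintro ⟨a, rfl⟩
    exact ⟨_, right_le_pair _ _, _, (right_le_pair _ _).trans (left_le_pair _ _), 
       ⟨⟨a.1, rfl⟩, ⟨a.2, rfl⟩⟩, rfl⟩
  · rintro ⟨_, -, _, -, ⟨⟨a, rfl⟩, ⟨b, rfl⟩⟩, rfl⟩
    exact ⟨(a, b), rfl⟩

theorem prodSnd : Def N fun p : α × β => p.2 := by
  have := bdd_comprehension (rangeMem (α := α)) (rangeMem (N := N) (α := β)) univ_mem_sets 0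
    (Bdd.bexLe (.var 1) (Bdd.bexLe (.var 2) (.and (.and (.mem (.var 1) 0) (.mem (.var 0) 1))
      (.eq (.var 3) (Bdd.pairTerm (Bdd.pairTerm (.var 1) (.var 0)) (.var 0))))))
    (P := fun n => ∃ x ≤ n, ∃ y ≤ n, (x ∈ Set.range (enc N (α := α)) ∧
        y ∈ Set.range (enc N (α := β))) ∧ n = pair (pair x y) y) (by simp [-Set.mem_range])
  change graph N _ ∈ _
  convert this using 1
  ext n
  constructor
  · rintro ⟨a, rfl⟩
    exact ⟨_, (left_le_pair _ _).trans (left_le_pair _ _), _, right_le_pair _ _, 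
       ⟨⟨a.1, rfl⟩, ⟨a.2, rfl⟩⟩, rfl⟩
  · rintro ⟨_, -, _, -, ⟨⟨a, rfl⟩, ⟨b, rfl⟩⟩, rfl⟩
    exact ⟨(a, b), rfl⟩

@[fun_prop]
theorem fst {f : α → β × γ} (hf : Def N f) : Def N fun a => (f a).1 := prodFst.comp hf

@[fun_prop]
theorem snd {f : α → β × γ} (hf : Def N f) : Def N fun a => (f a).2 := prodSnd.comp hf

theorem comp₂ {F : β → γ → δ} {f : α → β} {g : α → γ} (hF : Def N fun p : β × γ => F p.1 p.2)
    (hf : Def N f) (hg : Def N g) : Def N fun a => F (f a) (g a) :=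
  comp (g := fun p : β × γ => F p.1 p.2) hF (hf.prodMk hg)

theorem comp₃ {ε : Type*} [Cod N ε] {F : β → γ → δ → ε} {f : α → β} {g : α → γ} {h : α → δ}
    (hF : Def N fun p : (β × γ) × δ => F p.1.1 p.1.2 p.2)
    (hf : Def N f) (hg : Def N g) (hh : Def N h) : Def N fun a => F (f a) (g a) (h a) :=
  comp (g := fun p : (β × γ) × δ => F p.1.1 p.1.2 p.2) hF ((hf.prodMk hg).prodMk hh)

theorem binop {t : NumTerm} {F : N → N → N}
    (h : ∀ (x y : N) (e : ℕ → N), t.val (push y (push x e)) = F x y) :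
    Def N fun p : N × N => F p.1 p.2 := by
  have := bdd_comprehension (univ_mem_sets (N := N)) (univ_mem_sets (N := N)) univ_mem_sets 0
    (Bdd.bexLe (.var 1) (Bdd.bexLe (.var 2)
      (.eq (.var 3) (Bdd.pairTerm (Bdd.pairTerm (.var 1) (.var 0)) t))))
    (P := fun n => ∃ x ≤ n, ∃ y ≤ n, n = pair (pair x y) (F x y)) (by simp [h, -Set.mem_range])
  change graph N _ ∈ _
  convert this using 1
  ext n
  constructor
  · rintro ⟨a, rfl⟩
    exact ⟨_, (left_le_pair _ _).trans (left_le_pair _ _), _,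
      (right_le_pair _ _).trans (left_le_pair _ _), rfl⟩
  · rintro ⟨x, -, y, -, rfl⟩
    exact ⟨(x, y), rfl⟩

@[fun_prop]
theorem add {f g : α → N} (hf : Def N f) (hg : Def N g) : Def N fun a => f a + g a :=
  (binop (t := .add (.var 1) (.var 0)) (F := (· + ·)) (fun _ _ _ => rfl)).comp (hf.prodMk hg)

@[fun_prop]
theorem mul {f g : α → N} (hf : Def N f) (hg : Def N g) : Def N fun a => f a * g a :=
  (binop (t := .mul (.var 1) (.var 0)) (F := (· * ·)) (fun _ _ _ => rfl)).comp (hf.prodMk hg)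

@[fun_prop]
theorem numPair {f g : α → N} (hf : Def N f) (hg : Def N g) : Def N fun a => pair (f a) (g a) := by
  unfold pair; fun_prop

/-! ### Closure properties of computable predicates -/

@[fun_prop]
theorem and {P Q : α → Prop} (hP : Def N P) (hQ : Def N Q) : Def N fun a => P a ∧ Q a := by
  rw [iff_codes_mem] at *
  convert bdd_comprehension hP hQ hQ 0 (.and (.mem (.var 1) 0) (.mem (.var 1) 1))
    (P := fun n => n ∈ codes N P ∧ n ∈ codes N Q) (by simp [-Set.mem_range]) using 1
  ext n
  constructor
  · rintro ⟨a, ⟨h1, h2⟩, rfl⟩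
    exact ⟨⟨a, h1, rfl⟩, ⟨a, h2, rfl⟩⟩
  · rintro ⟨⟨a, h1, rfl⟩, h2⟩
    exact ⟨a, ⟨h1, enc_mem_codes.1 h2⟩, rfl⟩

@[fun_prop]
theorem not {P : α → Prop} (hP : Def N P) : Def N fun a => ¬ P a := by
  rw [iff_codes_mem] at *
  convert bdd_comprehension hP (rangeMem (α := α)) hP 0 (.and (.mem (.var 1) 1)
    (.neg (.mem (.var 1) 0))) (P := fun n => n ∈ R ∧ n ∉ codes N P) (by simp [-Set.mem_range]) using 1
  ext n
  constructor
  · rintro ⟨a, h, rfl⟩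
    exact ⟨⟨a, rfl⟩, fun h' => h (enc_mem_codes.1 h')⟩
  · rintro ⟨⟨a, rfl⟩, h2⟩
    exact ⟨a, fun h' => h2 (enc_mem_codes.2 h'), rfl⟩

@[fun_prop]
theorem or {P Q : α → Prop} (hP : Def N P) (hQ : Def N Q) : Def N fun a => P a ∨ Q a := by
  simpa only [not_and_or, not_not] using (hP.not.and hQ.not).not

theorem imp {P Q : α → Prop} (hP : Def N P) (hQ : Def N Q) : Def N fun a => P a → Q a := by
  simpa only [imp_iff_not_or] using hP.not.or hQ

@[fun_prop]
theorem iff {P Q : α → Prop} (hP : Def N P) (hQ : Def N Q) : Def N fun a => P a ↔ Q a := by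
  simpa only [iff_iff_implies_and_implies] using (hP.imp hQ).and (hQ.imp hP)

@[fun_prop]
theorem eq {f g : α → β} (hf : Def N f) (hg : Def N g) : Def N fun a => f a = g a := by
  have : Def N fun p : β × β => p.1 = p.2 := by
    rw [iff_codes_mem]
    convert bdd_comprehension (rangeMem (N := N) (α := β)) univ_mem_sets univ_mem_sets 0 (Bdd.bexLe (.var 1)
      (.and (.mem (.var 0) 0) (.eq (.var 2) (Bdd.pairTerm (.var 0) (.var 0)))))
      (P := fun n => ∃ x ≤ n, x ∈ Set.range (enc N (α := β)) ∧ n = pair x x)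
      (by simp [-Set.mem_range]) using 1
    ext n
    constructor
    · rintro ⟨⟨b, c⟩, rfl : b = c, rfl⟩
      exact ⟨_, left_le_pair _ _, ⟨b, rfl⟩, rfl⟩
    · rintro ⟨_, -, ⟨b, rfl⟩, rfl⟩
      exact ⟨(b, b), rfl, rfl⟩
  exact this.comp (hf.prodMk hg)

theorem num_lt : Def N fun p : N × N => p.1 < p.2 := by
  rw [iff_codes_mem]
  convert bdd_comprehension univ_mem_sets univ_mem_sets univ_mem_sets 0 (Bdd.bexLe (.var 1)
    (Bdd.bexLe (.var 2) (.and (.lt (.var 1) (.var 0))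
      (.eq (.var 3) (Bdd.pairTerm (.var 1) (.var 0))))))
    (P := fun n : N => ∃ x ≤ n, ∃ y ≤ n, x < y ∧ n = pair x y) (by simp [-Set.mem_range]) using 1
  ext n
  constructor
  · rintro ⟨⟨b, c⟩, h, rfl⟩
    exact ⟨_, left_le_pair _ _, _, right_le_pair _ _, h, rfl⟩
  · rintro ⟨x, -, y, -, h, rfl⟩
    exact ⟨(x, y), h, rfl⟩

@[fun_prop]
theorem lt {f g : α → N} (hf : Def N f) (hg : Def N g) : Def N fun a => f a < g a :=
  num_lt.comp (hf.prodMk hg)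

@[fun_prop]
theorem le {f g : α → N} (hf : Def N f) (hg : Def N g) : Def N fun a => f a ≤ g a := by
  simpa only [not_lt] using (hg.lt hf).not

@[fun_prop]
theorem mem {A : Set N} (hA : A ∈ sets (N := N)) {f : α → N} (hf : Def N f) :
    Def N fun a => f a ∈ A := by
  refine Def.comp (g := fun x : N => x ∈ A) ?_ hf
  rw [iff_codes_mem]
  convert hA using 1
  ext n
  exact ⟨fun ⟨a, h, h'⟩ => h' ▸ h, fun h => ⟨n, h, rfl⟩⟩

theorem mem_sets {P : N → Prop} (h : Def N P) : {x | P x} ∈ sets (N := N) := by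
  rw [iff_codes_mem] at h
  convert h using 1
  ext n
  exact ⟨fun h => ⟨n, h, rfl⟩, fun ⟨a, h, h'⟩ => h' ▸ h⟩

theorem ball {t : α → N} {P : α → N → Prop} (ht : Def N t)
    (hP : Def N fun p : α × N => P p.1 p.2) : Def N fun a => ∀ x < t a, P a x := by
  -- The bound is first a separate argument, hence a variable of the formula; composition then
  -- inserts `t`.
  have : Def N fun p : α × N => ∀ x < p.2, P p.1 x := by
    rw [iff_codes_mem] at *
    convert bdd_comprehension (rangeMem (α := α)) hP hP 0 (Bdd.bexLe (.var 1)
      (Bdd.bexLe (.var 2) (.and (.eq (.var 3) (Bdd.pairTerm (.var 1) (.var 0)))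
        (.and (.mem (.var 1) 0) (.ball (.var 0) (.mem (Bdd.pairTerm (.var 2) (.var 0)) 1))))))
      (P := fun n : N => ∃ x ≤ n, ∃ y ≤ n, n = pair x y ∧ x ∈ R ∧
        ∀ z < y, pair x z ∈ codes N fun p : α × N => P p.1 p.2) (by simp [-Set.mem_range]) using 1
    ext n
    have key : ∀ (a : α) (z : N), (pair (enc N a) z ∈ codes N fun p : α × N => P p.1 p.2) ↔
      P a z := fun a z => enc_mem_codes (P := fun p : α × N => P p.1 p.2) (a := (a, z))
    constructor
    · rintro ⟨⟨b, c⟩, h, rfl⟩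
      exact ⟨_, left_le_pair _ _, _, right_le_pair _ _, rfl, ⟨b, rfl⟩, fun z hz =>
        (key b z).2 (h z hz)⟩
    · rintro ⟨_, -, y, -, rfl, ⟨a, rfl⟩, h⟩
      exact ⟨(a, y), fun z hz => (key a z).1 (h z hz), rfl⟩
  exact Def.comp (g := fun p : α × N => ∀ x < p.2, P p.1 x) this (id.prodMk ht)

theorem bex {t : α → N} {P : α → N → Prop} (ht : Def N t)
    (hP : Def N fun p : α × N => P p.1 p.2) : Def N fun a => ∃ x < t a, P a x := by
  simpa using (ball (P := fun a x => ¬ P a x) ht hP.not).not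

end Def

/-! ### Induction, minimization and primitive recursion -/

section Recursion

variable {N : Type u} [Model N] {α : Type v} {β : Type w} [Cod N α] [Cod N β]

theorem def_induction {P : N → Prop} (hP : Def N P) (h0 : P 0) (hs : ∀ n, P n → P (n + 1)) (n : N) :
    P n :=
  bdd_induction (.mem (.var 1) 0) (fun _ => 0) _ (setEnv_mem hP.mem_sets hP.mem_sets hP.mem_sets)
    (by simp) h0 hs n

/-- Needed when the existence of a code is the induction claim: such a predicate need not be a set
of the model. -/
theorem sigma_induction {P : N → N → Prop} (hP : Def N fun p : N × N => P p.1 p.2)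
    (h0 : ∃ y, P 0 y) (hs : ∀ n, (∃ y, P n y) → ∃ y, P (n + 1) y) (n : N) : ∃ y, P n y := by
  rw [Def.iff_codes_mem] at hP
  refine exists_induction (.mem (Bdd.pairTerm (.var 1) (.var 0)) 0) (fun _ => 0) _
    (setEnv_mem hP hP hP) ?_ h0 hs n
  intro n y
  exact Def.enc_mem_codes (P := fun p : N × N => P p.1 p.2) (a := (n, y))

theorem Def.section_right {P : α → N → β} (hP : Def N fun p : α × N => P p.1 p.2) (a : α) :
    Def N (P a) :=
  Def.comp (g := fun p : α × N => P p.1 p.2) hP ((Def.const a).prodMk Def.id)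

theorem exists_least {P : N → Prop} (hP : Def N P) (h : ∃ n, P n) :
    ∃ m, P m ∧ ∀ k < m, ¬ P k := by
  by_contra! hm
  have key : ∀ n : N, ∀ k < n, ¬ P k := by
    refine def_induction (P := fun n : N => ∀ k < n, ¬ P k) ?_ ?_ ?_
    · exact Def.ball (by fun_prop) (by fun_prop)
    · exact fun k hk => absurd hk not_lt_zero
    · intro n hn k hk
      rcases (lt_succ_iff.1 hk).lt_or_eq with h | rfl
      · exact hn k h
      · intro hk
        obtain ⟨j, hj, hj'⟩ := hm k hk
        exact hn j hj hj'
  obtain ⟨n, hn⟩ := h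
  exact key (n + 1) n (lt_succ_iff.2 le_rfl) hn

theorem Def.of_graph {f : α → β} (h : Def N fun p : α × β => p.2 = f p.1) : Def N f := by
  rw [Def.iff_codes_mem] at h
  change graph N f ∈ _
  convert h using 1
  ext n
  constructor
  · rintro ⟨a, rfl⟩
    exact ⟨(a, f a), rfl, rfl⟩
  · rintro ⟨⟨a, b⟩, rfl : b = f a, rfl⟩
    exact ⟨a, rfl⟩

/-- Taking the least witness makes choice computable: being a witness with no smaller one is a
bounded condition. No choice axiom for the model is involved. -/
theorem exists_def_least {P : α → N → Prop} (hP : Def N fun p : α × N => P p.1 p.2)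
    (h : ∀ a, ∃ y, P a y) :
    ∃ f : α → N, Def N f ∧ (∀ a, P a (f a)) ∧ ∀ a, ∀ y < f a, ¬ P a y := by
  choose f hf using fun a => exists_least (hP.section_right a) (h a)
  refine ⟨f, Def.of_graph ?_, fun a => (hf a).1, fun a => (hf a).2⟩
  have : (fun p : α × N => p.2 = f p.1) = fun p => P p.1 p.2 ∧ ∀ y < p.2, ¬ P p.1 y := by
    ext ⟨a, y⟩
    constructor
    · rintro (rfl : y = f a)
      exact hf a
    · rintro ⟨h1, h2⟩
      rcases lt_trichotomy y (f a) with h' | h' | h'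
      exacts [absurd h1 ((hf a).2 _ h'), h', absurd (hf a).1 (h2 _ h')]
  rw [this]
  refine hP.and (Def.ball (by fun_prop) (Def.not ?_))
  exact hP.comp₂ (by fun_prop) (by fun_prop)

theorem exists_def {P : α → N → Prop} (hP : Def N fun p : α × N => P p.1 p.2)
    (h : ∀ a, ∃ y, P a y) : ∃ f : α → N, Def N f ∧ ∀ a, P a (f a) :=
  (exists_def_least hP h).imp fun _ h => ⟨h.1, h.2.1⟩

theorem exists_def_pair {P : α → N → N → Prop}
    (hP : Def N fun p : (α × N) × N => P p.1.1 p.1.2 p.2) (h : ∀ a, ∃ y z, P a y z) :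
    ∃ f g : α → N, Def N f ∧ Def N g ∧ ∀ a, P a (f a) (g a) := by
  -- Both values are searched for simultaneously through the code of their pair, which is decoded
  -- afterwards.
  obtain ⟨k, hk, hk'⟩ := exists_def
    (P := fun a w => ∃ y < w + 1, ∃ z < w + 1, w = pair y z ∧ P a y z)
    (by
      refine .bex (by fun_prop) (.bex (by fun_prop) (.and (by fun_prop) ?_))
      exact hP.comp₃ (by fun_prop) (by fun_prop) (by fun_prop)) (fun a => by
      obtain ⟨y, z, h⟩ := h a
      exact ⟨pair y z, y, left_lt_pair_succ y z, z, right_lt_pair_succ y z, rfl, h⟩)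
  obtain ⟨f, hf, hf'⟩ := exists_def (P := fun a y => ∃ z < k a + 1, k a = pair y z)
    (Def.bex (by fun_prop) (by fun_prop)) (fun a => by
      obtain ⟨y, hy, z, hz, h1, h2⟩ := hk' a
      exact ⟨y, z, hz, h1⟩)
  obtain ⟨g, hg, hg'⟩ := exists_def (P := fun a z => k a = pair (f a) z) (by fun_prop) (fun a => by
      obtain ⟨z, -, hz⟩ := hf' a
      exact ⟨z, hz⟩)
  refine ⟨f, g, hf, hg, fun a => ?_⟩
  obtain ⟨y, hy, z, hz, h1, h2⟩ := hk' a
  rw [hg' a, pair_inj] at h1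
  rwa [h1.1, h1.2]

/-! ### Finite sets -/

/-- All quantifiers are bounded by the code or its components (the quotient is at most `n` because
the modulus is positive), so membership is computable. -/
theorem finMem_iff {i t : N} : FinMem i t ↔ ∃ k < t + 1, ∃ m < t + 1, ∃ n < t + 1,
    t = pair k (pair m n) ∧ i < k ∧ ∃ q < n + 1, n = (m * (i + 1) + 1) * q := by
  constructor
  · rintro ⟨k, m, n, rfl, hi, q, hq⟩
    refine ⟨k, left_lt_pair_succ _ _, m, lt_succ_iff.2 ((left_le_pair _ _).trans (right_le_pair _ _)),
      n, lt_succ_iff.2 ((right_le_pair _ _).trans (right_le_pair _ _)), rfl, hi, q, ?_, hq⟩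
    rw [lt_succ_iff, hq]
    exact le_mul_of_one_le_left zero_le le_add_self
  · rintro ⟨k, -, m, -, n, -, h, hi, q, -, hq⟩
    exact ⟨k, m, n, h, hi, q, hq⟩

@[fun_prop]
theorem Def.finMem {f g : α → N} (hf : Def N f) (hg : Def N g) :
    Def N fun a => FinMem (f a) (g a) := by
  simp only [finMem_iff]
  refine .bex (by fun_prop) (.bex (by fun_prop) (.bex (by fun_prop) (.and (by fun_prop)
    (.and (by fun_prop) (.bex (by fun_prop) (by fun_prop))))))

theorem _root_.SOA.FinMem.lt {i t : N} (h : FinMem i t) : i < t := by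
  obtain ⟨k, m, n, rfl, hi, -⟩ := h
  exact hi.trans_le (left_le_pair _ _)

theorem isTriple_iff {t : N} : IsTriple t ↔ ∃ k < t + 1, ∃ m < t + 1, ∃ n < t + 1,
    t = pair k (pair m n) := by
  constructor
  · rintro ⟨k, m, n, rfl⟩
    exact ⟨k, left_lt_pair_succ _ _, m,
      lt_succ_iff.2 ((left_le_pair _ _).trans (right_le_pair _ _)),
      n, lt_succ_iff.2 ((right_le_pair _ _).trans (right_le_pair _ _)), rfl⟩
  · rintro ⟨k, -, m, -, n, -, h⟩
    exact ⟨k, m, n, h⟩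

@[fun_prop]
theorem Def.isTriple {f : α → N} (hf : Def N f) : Def N fun a => IsTriple (f a) := by
  simp only [isTriple_iff]
  exact .bex (by fun_prop) (.bex (by fun_prop) (.bex (by fun_prop) (by fun_prop)))

theorem forall_finMem_iff {s t : N} : (∀ i : N, FinMem i s ↔ FinMem i t) ↔
    ∀ i < s + t, (FinMem i s ↔ FinMem i t) := by
  refine ⟨fun h i _ => h i, fun h i => ⟨fun hi => ?_, fun hi => ?_⟩⟩
  · exact (h i (hi.lt.trans_le le_self_add)).1 hi
  · exact (h i (hi.lt.trans_le le_add_self)).2 hi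

@[fun_prop]
theorem Def.isFinSet {f : α → N} (hf : Def N f) : Def N fun a => IsFinSet (f a) := by
  simp only [IsFinSet, forall_finMem_iff]
  exact .and (by fun_prop) (.ball (by fun_prop) (.imp (by fun_prop) (.not (.ball (by fun_prop)
    (by fun_prop)))))

/-- Codes of finite sets are least representatives; if two codes with the same elements differed,
the smaller would refute minimality of the larger. -/
theorem isFinSet_ext {s t : N} (hs : IsFinSet s) (ht : IsFinSet t)
    (h : ∀ i : N, FinMem i s ↔ FinMem i t) : s = t := by
  rcases lt_trichotomy s t with h' | h' | h'
  · exact absurd h (ht.2 s h' hs.1)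
  · exact h'
  · exact absurd (fun i => (h i).symm) (hs.2 t h' ht.1)

/-! ### Coprime moduli and the existence of codes for finite sets -/

theorem exists_common_multiple (k : N) : ∃ m : N, 0 < m ∧ ∀ i < k, ∃ q, m = (i + 1) * q := by
  suffices h : ∃ m : N, 0 < m ∧ ∀ i < k, ∃ q < m + 1, m = (i + 1) * q by
    obtain ⟨m, hm, h⟩ := h
    exact ⟨m, hm, fun i hi => let ⟨q, _, hq⟩ := h i hi; ⟨q, hq⟩⟩
  refine sigma_induction (P := fun k m : N => 0 < m ∧ ∀ i < k, ∃ q < m + 1, m = (i + 1) * q)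
    ?_ ?_ ?_ k
  · exact .and (by fun_prop) (.ball (by fun_prop) (.bex (by fun_prop) (by fun_prop)))
  · exact ⟨1, one_pos, fun i hi => absurd hi not_lt_zero⟩
  · rintro k ⟨m, hm, h⟩
    refine ⟨(k + 1) * m, by positivity, fun i hi => ?_⟩
    rcases (lt_succ_iff.1 hi).lt_or_eq with h' | rfl
    · obtain ⟨q, hq, hq'⟩ := h i h'
      refine ⟨(k + 1) * q, ?_, by rw [hq']; ring⟩
      rw [lt_succ_iff] at *
      gcongr
    · exact ⟨m, lt_succ_iff.2 (le_mul_of_one_le_left zero_le le_add_self), rfl⟩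

theorem dvd_of_dvd_add {a b c : N} (h : a ∣ b + c) (h' : a ∣ b) : a ∣ c := by
  obtain ⟨x, rfl⟩ := h'
  obtain ⟨y, hy⟩ := h
  rcases le_total x y with hxy | hxy
  · obtain ⟨z, rfl⟩ := Model.le_iff.1 hxy
    rw [mul_add] at hy
    exact ⟨z, add_left_cancel hy⟩
  · obtain ⟨z, rfl⟩ := Model.le_iff.1 hxy
    have : c = 0 := by
      have h1 : a * y + (a * z + c) = a * y + 0 := by
        rw [add_zero, ← add_assoc, ← mul_add, hy]
      exact (add_eq_zero.1 (add_left_cancel h1)).2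
    simp [this]

/-- If the difference of `a` and `b` divides `m`, then `m * a + 1` and `m * b + 1` are coprime. -/
theorem dvd_of_dvd_mul {m n i a b c : N} (hd : a = b + c ∨ b = a + c) (hc : c ∣ m)
    (ha : i = m * a + 1) (h : i ∣ n * (m * b + 1)) : i ∣ n := by
  -- Modulo `i`, the product `m * a` is -1, so `m` is invertible.
  have cancel : ∀ x : N, i ∣ x * m → i ∣ x := by
    intro x hx
    have h1 : i ∣ x * m * a + x := ⟨x, by rw [ha]; ring⟩
    exact dvd_of_dvd_add h1 (hx.mul_right a)
  -- This is the difference of `n * (m * a + 1)` and `n * (m * b + 1)`, both of which `i` divides.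
  have h1 : i ∣ n * (m * c) := by
    rcases hd with rfl | rfl
    · have h2 : i ∣ n * (m * b + 1) + n * (m * c) := ⟨n, by rw [ha]; ring⟩
      exact dvd_of_dvd_add h2 h
    · have h2 : n * (m * (a + c) + 1) = i * n + n * (m * c) := by rw [ha]; ring
      rw [h2] at h
      exact dvd_of_dvd_add h (dvd_mul_right i n)
  obtain ⟨q, hq⟩ := hc
  refine cancel n (cancel _ ?_)
  have h2 : n * m * m = n * (m * c) * q := by
    calc n * m * m = n * m * (c * q) := by rw [← hq]
      _ = _ := by ring
  rw [h2]
  exact h1.mul_right q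

/-- This is Gödel's coding: for a common multiple `m` of `1,…,k`, the moduli `m(i+1)+1` with `i < k`
are pairwise coprime, because differences of indices divide `m`. The last component is built, by
`Σ⁰₁` induction, as the product of the moduli whose index satisfies `P`. -/
theorem exists_triple {P : N → Prop} (hP : Def N P) (k : N) :
    ∃ t : N, IsTriple t ∧ ∀ i : N, FinMem i t ↔ i < k ∧ P i := by
  -- This `m` takes the place of a factorial; recursion is not yet available and will itself rest on
  -- finite sets.
  obtain ⟨m, hm, hm'⟩ := exists_common_multiple k
  have dvd_iff : ∀ a b : N, a ∣ b ↔ ∃ q < b + 1, b = a * q := by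
    intro a b
    constructor
    · rintro ⟨q, rfl⟩
      rcases eq_or_ne a 0 with rfl | ha
      · exact ⟨0, by simp, by simp⟩
      · obtain ⟨a, rfl⟩ := exists_eq_succ ha
        exact ⟨q, lt_succ_iff.2 (le_mul_of_one_le_left zero_le le_add_self), rfl⟩
    · rintro ⟨q, -, h⟩
      exact ⟨q, h⟩
  have hdvd : ∀ {f g : (N × N) × N → N}, Def N f → Def N g → Def N fun a => f a ∣ g a := by
    intro f g hf hg
    simp only [dvd_iff]
    exact .bex (by fun_prop) (by fun_prop)
  have coprime : ∀ i < k, ∀ j < k, i ≠ j → ∀ n, (m * (i + 1) + 1) ∣ n * (m * (j + 1) + 1) →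
      (m * (i + 1) + 1) ∣ n := by
    intro i hi j hj hij n h
    rcases hij.lt_or_gt with h' | h'
    · obtain ⟨c, rfl⟩ := Model.lt_iff.1 h'
      refine dvd_of_dvd_mul (c := c + 1) (.inr (by ring)) ?_ rfl h
      exact hm' c (lt_of_le_of_lt (le_trans (le_self_add (b := 1)) le_add_self) hj)
    · obtain ⟨c, rfl⟩ := Model.lt_iff.1 h'
      refine dvd_of_dvd_mul (c := c + 1) (.inl (by ring)) ?_ rfl h
      exact hm' c (lt_of_le_of_lt (le_trans (le_self_add (b := 1)) le_add_self) hi)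
  have step : ∀ j : N, ∃ n : N, ∀ i < k, (m * (i + 1) + 1) ∣ n ↔ i < j ∧ P i := by
    refine sigma_induction (P := fun j n : N => ∀ i < k, (m * (i + 1) + 1) ∣ n ↔ i < j ∧ P i)
      ?_ ?_ ?_
    · exact .ball (by fun_prop) (.iff (hdvd (by fun_prop) (by fun_prop)) (by fun_prop))
    · refine ⟨1, fun i hi => ⟨fun h => ?_, fun h => absurd h.1 not_lt_zero⟩⟩
      exfalso
      obtain ⟨q, hq⟩ := h
      rcases eq_or_ne q 0 with rfl | h0
      · simp at hq
      · obtain ⟨q, rfl⟩ := exists_eq_succ h0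
        have h1 : (m * (i + 1) + 1) * (q + 1) = 1 + (m * (i + 1) * (q + 1) + q) := by ring
        rw [h1] at hq
        have h2 := (add_eq_zero.1 (add_left_cancel (a := (1 : N)) ((add_zero 1).trans hq)).symm).1
        -- Since `m` is positive, every modulus exceeds 1 and cannot divide the empty product.
        have h3 : 0 < m * (i + 1) * (q + 1) := by positivity
        exact h3.ne' h2
    · rintro j ⟨n, hn⟩
      by_cases hj : j < k ∧ P j
      · refine ⟨n * (m * (j + 1) + 1), fun i hi => ?_⟩
        rcases eq_or_ne i j with rfl | hij
        · exact ⟨fun _ => ⟨lt_succ_iff.2 le_rfl, hj.2⟩, fun _ => dvd_mul_left _ _⟩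
        · have h1 : i < j + 1 ↔ i < j := by rw [lt_succ_iff, le_iff_lt_or_eq]; tauto
          rw [h1, ← hn i hi]
          exact ⟨coprime i hi j hj.1 hij n, fun h => h.mul_right _⟩
      · refine ⟨n, fun i hi => ?_⟩
        rw [hn i hi]
        refine and_congr_left fun hPi => ⟨fun h => h.trans_le le_self_add, fun h => ?_⟩
        refine lt_of_le_of_ne (lt_succ_iff.1 h) ?_
        rintro rfl
        exact hj ⟨hi, hPi⟩
  obtain ⟨n, hn⟩ := step k
  refine ⟨pair k (pair m n), ⟨_, _, _, rfl⟩, fun i => ⟨?_, ?_⟩⟩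
  · rintro ⟨k', m', n', h, hi, hq⟩
    obtain ⟨h1, h2⟩ := pair_inj.1 h
    obtain ⟨rfl, rfl⟩ := pair_inj.1 h2
    rw [← h1] at hi
    exact (hn i hi).1 hq
  · rintro ⟨hi, hPi⟩
    exact ⟨k, m, n, rfl, hi, (hn i hi).2 ⟨hi, hPi⟩⟩

theorem exists_finSet {P : N → Prop} (hP : Def N P) (k : N) :
    ∃ t : N, IsFinSet t ∧ ∀ i : N, FinMem i t ↔ i < k ∧ P i := by
  obtain ⟨t, ht, ht'⟩ := exists_triple hP k
  obtain ⟨s, ⟨hs, hs'⟩, hmin⟩ := exists_least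
    (P := fun s : N => IsTriple s ∧ ∀ i : N, FinMem i s ↔ FinMem i t)
    (by simp only [forall_finMem_iff]; exact .and (by fun_prop) (.ball (by fun_prop) (by fun_prop)))
    ⟨t, ht, fun _ => Iff.rfl⟩
  refine ⟨s, ⟨hs, fun r hr hr' h => hmin r hr ⟨hr', fun i => (h i).trans (hs' i)⟩⟩,
    fun i => (hs' i).trans (ht' i)⟩

/-- The code of the finite set of all `i < k` with property `P`. -/
noncomputable def setCode (k : N) (P : N → Prop) : N :=
  Classical.epsilon fun t => IsFinSet t ∧ ∀ i : N, FinMem i t ↔ i < k ∧ P i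

theorem isFinSet_setCode {P : N → Prop} (hP : Def N P) (k : N) : IsFinSet (setCode k P) :=
  (Classical.epsilon_spec (exists_finSet hP k)).1

theorem finMem_setCode {P : N → Prop} (hP : Def N P) {k i : N} :
    FinMem i (setCode k P) ↔ i < k ∧ P i :=
  (Classical.epsilon_spec (exists_finSet hP k)).2 i

/-- Although the code is chosen nonconstructively, canonicity makes its graph computable: it
suffices to check that `t` is a least representative with the right elements below `t + k`. -/
theorem Def.setCode {k : α → N} {P : α → N → Prop} (hk : Def N k)
    (hP : Def N fun p : α × N => P p.1 p.2) : Def N fun a => setCode (k a) (P a) := by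
  refine Def.of_graph ?_
  have : (fun p : α × N => p.2 = Model.setCode (k p.1) (P p.1)) = fun p => IsFinSet p.2 ∧
      ∀ i < p.2 + k p.1, FinMem i p.2 ↔ i < k p.1 ∧ P p.1 i := by
    ext ⟨a, t⟩
    have ha := hP.section_right a
    constructor
    · rintro h
      obtain rfl : t = Model.setCode (k a) (P a) := h
      exact ⟨isFinSet_setCode ha _, fun i _ => finMem_setCode ha⟩
    · rintro ⟨h1, h2⟩
      refine isFinSet_ext h1 (isFinSet_setCode ha _) fun i => ?_
      rw [finMem_setCode ha]
      constructor
      · exact fun hi => (h2 i (hi.lt.trans_le le_self_add)).1 hi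
      · exact fun hi => (h2 i (hi.1.trans_le le_add_self)).2 hi
  rw [this]
  refine .and (by fun_prop) (.ball (by fun_prop) (.iff (by fun_prop) (.and (by fun_prop) ?_)))
  exact hP.comp₂ (by fun_prop) (by fun_prop)

/-! ### Primitive recursion -/

/-- The finite set `s` contains the graph of the function that is defined by recursion from `g` and
`h`, up to the argument `n`. -/
def IsApprox (g : N) (h : N → N → N) (n s : N) : Prop :=
  FinMem (pair 0 g) s ∧ (∀ i < n, ∃ x < s, FinMem (pair i x) s ∧ FinMem (pair (i + 1) (h i x)) s) ∧
    ∀ i < n + 1, ∀ x < s, ∀ y < s, FinMem (pair i x) s → FinMem (pair i y) s → x = y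

theorem FinMem.right_lt {i x s : N} (h : FinMem (pair i x) s) : x < s :=
  (right_le_pair i x).trans_lt h.lt

theorem Def.isApprox {g n s : α → N} {h : α → N → N → N} (hg : Def N g) (hn : Def N n)
    (hs : Def N s) (hh : Def N fun p : (α × N) × N => h p.1.1 p.1.2 p.2) :
    Def N fun a => IsApprox (g a) (h a) (n a) (s a) := by
  refine .and (by fun_prop) (.and (.ball (by fun_prop) (.bex (by fun_prop) (.and (by fun_prop)
    (.finMem (.numPair (by fun_prop) ?_) (by fun_prop)))))
    (.ball (by fun_prop) (.ball (by fun_prop) (.ball (by fun_prop) (.imp (by fun_prop)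
    (.imp (by fun_prop) (by fun_prop)))))))
  exact hh.comp₃ (by fun_prop) (by fun_prop) (by fun_prop)

theorem IsApprox.exists_value {g n s : N} {h : N → N → N} (H : IsApprox g h n s) {i : N}
    (hi : i ≤ n) : ∃ x, FinMem (pair i x) s := by
  rcases hi.lt_or_eq with hi | rfl
  · obtain ⟨x, -, hx, -⟩ := H.2.1 i hi
    exact ⟨x, hx⟩
  · rcases eq_or_ne i 0 with rfl | h0
    · exact ⟨_, H.1⟩
    · obtain ⟨j, rfl⟩ := exists_eq_succ h0
      obtain ⟨x, -, -, hx⟩ := H.2.1 j (lt_succ_iff.2 le_rfl)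
      exact ⟨_, hx⟩

theorem IsApprox.unique {g n n' s s' : N} {h : N → N → N} (H : IsApprox g h n s)
    (H' : IsApprox g h n' s') (i : N) : i ≤ n → i ≤ n' → ∀ x y : N, FinMem (pair i x) s →
    FinMem (pair i y) s' → x = y := by
  -- Bounding the values by the codes makes the claim computable, as induction requires.
  suffices i ≤ n → i ≤ n' → ∀ x < s, ∀ y < s', FinMem (pair i x) s → FinMem (pair i y) s' → x = y
    from fun h1 h2 x y hx hy =>
      this h1 h2 x (FinMem.right_lt hx) y (FinMem.right_lt hy) hx hy
  have func : ∀ i ≤ n, ∀ x y, FinMem (pair i x) s → FinMem (pair i y) s → x = y :=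
    fun i hi x y hx hy => H.2.2 i (lt_succ_iff.2 hi) x (FinMem.right_lt hx) y
      (FinMem.right_lt hy) hx hy
  have func' : ∀ i ≤ n', ∀ x y, FinMem (pair i x) s' → FinMem (pair i y) s' → x = y :=
    fun i hi x y hx hy => H'.2.2 i (lt_succ_iff.2 hi) x (FinMem.right_lt hx) y
      (FinMem.right_lt hy) hx hy
  refine def_induction (P := fun i => i ≤ n → i ≤ n' → ∀ x < s, ∀ y < s', FinMem (pair i x) s →
    FinMem (pair i y) s' → x = y) ?_ ?_ ?_ i
  · exact .imp (by fun_prop) (.imp (by fun_prop) (.ball (by fun_prop) (.ball (by fun_prop)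
      (.imp (by fun_prop) (.imp (by fun_prop) (by fun_prop))))))
  · intro h1 h2 x _ y _ hx hy
    rw [func 0 h1 x g hx H.1, func' 0 h2 y g hy H'.1]
  · intro i ih h1 h2 x _ y _ hx hy
    obtain ⟨z, hz1, hz2, hz3⟩ := H.2.1 i (succ_le_iff.1 h1)
    obtain ⟨w, hw1, hw2, hw3⟩ := H'.2.1 i (succ_le_iff.1 h2)
    have := ih (le_self_add.trans h1) (le_self_add.trans h2) z hz1 w hw1 hz2 hw2
    subst this
    rw [func _ h1 _ _ hx hz3, func' _ h2 _ _ hy hw3]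

theorem exists_isApprox (g : N) {h : N → N → N} (hh : Def N fun p : N × N => h p.1 p.2) (n : N) :
    ∃ s, IsApprox g h n s := by
  refine sigma_induction (P := fun n s => IsApprox g h n s) ?_ ?_ ?_ n
  · refine Def.isApprox (h := fun _ => h) (by fun_prop) (by fun_prop) (by fun_prop) ?_
    exact hh.comp₂ (by fun_prop) (by fun_prop)
  · have hd : Def N fun z : N => z = pair 0 g := by fun_prop
    refine ⟨setCode (pair 0 g + 1) (fun z => z = pair 0 g), ?_, ?_, ?_⟩
    · exact (finMem_setCode hd).2 ⟨lt_succ_iff.2 le_rfl, rfl⟩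
    · exact fun i hi => absurd hi not_lt_zero
    · intro i hi x _ y _ hx hy
      rw [finMem_setCode hd, pair_inj] at hx hy
      rw [hx.2.2, hy.2.2]
  · rintro n ⟨s, hs⟩
    obtain ⟨x, hx⟩ := hs.exists_value le_rfl
    set w := pair (n + 1) (h n x) with hw
    -- Only entries at arguments up to `n` are kept: `s` may contain arbitrary entries at `n + 1`,
    -- which would conflict with the new value `w`.
    have hd : Def N fun z : N => (FinMem z s ∧ ∃ i < n + 1, ∃ x < s, z = pair i x) ∨ z = w :=
      .or (.and (by fun_prop) (.bex (by fun_prop) (.bex (by fun_prop) (by fun_prop))))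
        (by fun_prop)
    have old : ∀ i ≤ n, ∀ x, FinMem (pair i x) (setCode (s + (w + 1))
        fun z => (FinMem z s ∧ ∃ i < n + 1, ∃ x < s, z = pair i x) ∨ z = w) ↔
        FinMem (pair i x) s := by
      intro i hi x
      rw [finMem_setCode hd]
      constructor
      · rintro ⟨-, h | h⟩
        · exact h.1
        · rw [hw, pair_inj] at h
          exact absurd (h.1 ▸ hi) (not_le.2 (lt_succ_iff.2 le_rfl))
      · exact fun h => ⟨h.lt.trans_le le_self_add, .inl ⟨h, i, lt_succ_iff.2 hi, x,
          FinMem.right_lt h, rfl⟩⟩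
    have new : ∀ y, FinMem (pair (n + 1) y) (setCode (s + (w + 1))
        fun z => (FinMem z s ∧ ∃ i < n + 1, ∃ x < s, z = pair i x) ∨ z = w) ↔ y = h n x := by
      intro y
      rw [finMem_setCode hd]
      constructor
      · rintro ⟨-, ⟨-, i, hi, z, -, hz⟩ | hz⟩
        · exact absurd hi ((pair_inj.1 hz).1 ▸ lt_irrefl _)
        · exact (pair_inj.1 hz).2
      · rintro rfl
        exact ⟨lt_of_lt_of_le (lt_succ_iff.2 le_rfl) le_add_self, .inr rfl⟩
    refine ⟨_, (old 0 zero_le _).2 hs.1, ?_, ?_⟩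
    · intro i hi
      rcases (lt_succ_iff.1 hi).lt_or_eq with hi | rfl
      · obtain ⟨y, -, hy, hy'⟩ := hs.2.1 i hi
        have := (old i hi.le y).2 hy
        exact ⟨y, FinMem.right_lt this, this, (old _ (succ_le_iff.2 hi) _).2 hy'⟩
      · have := (old i le_rfl x).2 hx
        exact ⟨x, FinMem.right_lt this, this, (new _).2 rfl⟩
    · intro i hi y _ z _ hy hz
      rcases (lt_succ_iff.1 hi).lt_or_eq with hi | rfl
      · rw [lt_succ_iff] at hi
        rw [old i hi] at hy hz
        exact hs.2.2 i (lt_succ_iff.2 hi) y (FinMem.right_lt hy) z (FinMem.right_lt hz) hy hz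
      · rw [new] at hy hz
        rw [hy, hz]

/-- The value at `n` is found by searching for it together with an approximation up to `n` that
contains it. Uniqueness of values across approximations gives the recursion equations. -/
theorem exists_recursion {g : α → N} {h : α → N → N → N} (hg : Def N g)
    (hh : Def N fun p : (α × N) × N => h p.1.1 p.1.2 p.2) :
    ∃ F : α → N → N, Def N (fun p : α × N => F p.1 p.2) ∧ (∀ a, F a 0 = g a) ∧
      ∀ a n, F a (n + 1) = h a n (F a n) := by
  have hh' : ∀ a, Def N fun p : N × N => h a p.1 p.2 := fun a =>
    hh.comp₃ (by fun_prop) (by fun_prop) (by fun_prop)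
  obtain ⟨F, s, hF, -, H⟩ := exists_def_pair (α := α × N)
    (P := fun p y s => IsApprox (g p.1) (h p.1) p.2 s ∧ FinMem (pair p.2 y) s)
    (.and (Def.isApprox (h := fun p : ((α × N) × N) × N => h p.1.1.1) (by fun_prop) (by fun_prop)
      (by fun_prop)
      (hh.comp₃ (by fun_prop) (by fun_prop) (by fun_prop))) (by fun_prop))
    (fun p => by
      obtain ⟨s, hs⟩ := exists_isApprox (g p.1) (hh' p.1) p.2
      obtain ⟨y, hy⟩ := hs.exists_value le_rfl
      exact ⟨y, s, hs, hy⟩)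
  refine ⟨fun a n => F (a, n), hF, fun a => ?_, fun a n => ?_⟩
  · obtain ⟨h1, h2⟩ := H (a, 0)
    exact h1.unique h1 0 zero_le zero_le _ _ h2 h1.1
  · obtain ⟨h1, h2⟩ := H (a, n)
    obtain ⟨h1', h2'⟩ := H (a, n + 1)
    obtain ⟨x, -, hx, hx'⟩ := h1'.2.1 n (lt_succ_iff.2 le_rfl)
    have := h1.unique h1' n le_rfl le_self_add _ _ h2 hx
    subst this
    exact h1'.unique h1' (n + 1) le_rfl le_rfl _ _ h2' hx'

end Recursion
/-! ### Increasing functions and their codes -/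

section Morphisms

variable {N : Type u} [Model N] {α : Type v} [Cod N α]

open Classical in
theorem Def.ite {P : α → Prop} {f g : α → N} (hP : Def N P) (hf : Def N f) (hg : Def N g) :
    Def N fun a => if P a then f a else g a := by
  refine Def.of_graph ?_
  have : (fun p : α × N => p.2 = if P p.1 then f p.1 else g p.1) = fun p =>
      (P p.1 ∧ p.2 = f p.1) ∨ (¬ P p.1 ∧ p.2 = g p.1) := by
    ext ⟨a, y⟩
    by_cases h : P a <;> simp [h]
  rw [this]
  fun_prop

/-- The function `F` restricts to a strictly increasing function from `{0,…,m-1}` to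
`{0,…,n-1}`. -/
structure IncFun (m n : N) (F : N → N) : Prop where
  isDef : Def N F
  lt : ∀ i < m, F i < n
  mono : ∀ i j, i < j → j < m → F i < F j

namespace IncFun

variable {k l m n : N} {F G : N → N}

theorem le_of_le (h : IncFun m n F) {i j : N} (hi : i < m) (hij : F i ≤ F j) : i ≤ j := by
  by_contra! h'
  exact hij.not_gt (h.mono _ _ h' hi)

theorem lt_of_lt (h : IncFun m n F) {i j : N} (hi : i < m) (hij : F i < F j) : i < j := by
  refine lt_of_le_of_ne (h.le_of_le hi hij.le) ?_
  rintro rfl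
  exact lt_irrefl _ hij

theorem inj (h : IncFun m n F) {i j : N} (hi : i < m) (hj : j < m) (hij : F i = F j) : i = j :=
  le_antisymm (h.le_of_le hi hij.le) (h.le_of_le hj hij.ge)

protected theorem id (h : m ≤ n) : IncFun m n fun i => i :=
  ⟨by fun_prop, fun _ hi => hi.trans_le h, fun _ _ h _ => h⟩

theorem comp (hG : IncFun m n G) (hF : IncFun l m F) : IncFun l n fun i => G (F i) :=
  ⟨hG.isDef.comp hF.isDef, fun i hi => hG.lt _ (hF.lt i hi),
    fun i j hij hj => hG.mono _ _ (hF.mono i j hij hj) (hF.lt j hj)⟩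

theorem cod (hF : IncFun m l F) (h : ∀ i < m, F i < n) : IncFun m n F :=
  ⟨hF.isDef, h, hF.mono⟩

/-- A function factors through any function with larger range. -/
theorem exists_factor (hF : IncFun k n F) (hG : IncFun l n G)
    (h : ∀ i < k, ∃ j < l, G j = F i) : ∃ H, IncFun k l H ∧ ∀ i < k, G (H i) = F i := by
  have hFd := hF.isDef
  have hGd := hG.isDef
  -- The search must succeed at every argument, so the condition is made vacuous outside the domain,
  -- where 0 is a witness.
  obtain ⟨H, hH, hH'⟩ := exists_def (P := fun i j : N => i < k → j < l ∧ G j = F i)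
    (.imp (by fun_prop) (by fun_prop)) (fun i => by
      by_cases hi : i < k
      · obtain ⟨j, hj, hj'⟩ := h i hi
        exact ⟨j, fun _ => ⟨hj, hj'⟩⟩
      · exact ⟨0, fun h => absurd h hi⟩)
  refine ⟨H, ⟨hH, fun i hi => (hH' i hi).1, fun i j hij hj => ?_⟩, fun i hi => (hH' i hi).2⟩
  have hi := hij.trans hj
  refine hG.lt_of_lt (hH' i hi).1 ?_
  rw [(hH' i hi).2, (hH' j hj).2]
  exact hF.mono i j hij hj

theorem le_apply (hF : IncFun m n F) : ∀ i < m, i ≤ F i := by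
  have hFd := hF.isDef
  refine def_induction (P := fun i => i < m → i ≤ F i) (.imp (by fun_prop) (by fun_prop)) ?_ ?_
  · exact fun _ => zero_le
  · intro i ih hi
    have h : i < i + 1 := lt_succ_iff.2 le_rfl
    exact succ_le_iff.2 ((ih (h.trans hi)).trans_lt (hF.mono _ _ h hi))

/-- Factoring `F` through `G` gives an increasing map from `m` to `m'`. Such a map dominates the
identity, and its last argument shows `m ≤ m'`. -/
theorem le_of_range {m' n' : N} (hF : IncFun m n F) (hG : IncFun m' n' G)
    (h : ∀ i < m, ∃ j < m', G j = F i) : m ≤ m' := by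
  obtain ⟨H, hH, -⟩ := exists_factor (n := n + n') (hF.cod fun i hi => (hF.lt i hi).trans_le
    le_self_add) (hG.cod fun i hi => (hG.lt i hi).trans_le le_add_self) h
  rcases eq_or_ne m 0 with rfl | h0
  · exact zero_le
  · obtain ⟨p, rfl⟩ := exists_eq_succ h0
    have hp : p < p + 1 := lt_succ_iff.2 le_rfl
    exact succ_le_iff.2 ((hH.le_apply p hp).trans_lt (hH.lt p hp))

/-- An increasing function is determined by its range. -/
theorem eq_of_range {m' n' : N} (hF : IncFun m n F) (hG : IncFun m' n' G)
    (h : ∀ i < m, ∃ j < m', G j = F i) (h' : ∀ j < m', ∃ i < m, F i = G j) :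
    m = m' ∧ ∀ i < m, F i = G i := by
  have hm := le_antisymm (hF.le_of_range hG h) (hG.le_of_range hF h')
  subst hm
  refine ⟨rfl, ?_⟩
  -- By symmetry one inequality is enough: if `F = G ∘ H`, then `i ≤ H i` gives `G i ≤ F i`.
  suffices ∀ {F G : N → N} {n n' : N}, IncFun m n F → IncFun m n' G →
      (∀ i < m, ∃ j < m, G j = F i) → ∀ i < m, G i ≤ F i from fun i hi =>
    le_antisymm (this hG hF h' i hi) (this hF hG h i hi)
  intro F G n n' hF hG h i hi
  obtain ⟨H, hH, hH'⟩ := exists_factor (n := n + n') (hF.cod fun i hi => (hF.lt i hi).trans_le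
    le_self_add) (hG.cod fun i hi => (hG.lt i hi).trans_le le_add_self) h
  rw [← hH' i hi]
  rcases (hH.le_apply i hi).lt_or_eq with h1 | h1
  · exact (hG.mono _ _ h1 (hH.lt i hi)).le
  · rw [← h1]

end IncFun

/-! ### Codes of finite sequences and morphisms -/

/-- The code of a finite sequence of length `m` with values below `n`. -/
noncomputable def seqCode (m n : N) (F : N → N) : N :=
  setCode (pair m n) fun z => ∃ i < m, z = pair i (F i)

theorem def_seq {m : N} {F : N → N} (hF : Def N F) : Def N fun z => ∃ i < m, z = pair i (F i) :=
  .bex (by fun_prop) (by fun_prop)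

theorem pair_lt_pair {i m j n : N} (hi : i < m) (hj : j < n) : pair i j < pair m n :=
  pair_lt_of_add_lt (add_lt_add hi hj)

theorem finMem_seqCode {m n z : N} {F : N → N} (hF : Def N F) (h : ∀ i < m, F i < n) :
    FinMem z (seqCode m n F) ↔ ∃ i < m, z = pair i (F i) := by
  rw [seqCode, finMem_setCode (def_seq hF), and_iff_right_iff_imp]
  rintro ⟨i, hi, rfl⟩
  exact pair_lt_pair hi (h i hi)

theorem pair_finMem_seqCode {m n i j : N} {F : N → N} (hF : Def N F) (h : ∀ i < m, F i < n) :
    FinMem (pair i j) (seqCode m n F) ↔ i < m ∧ j = F i := by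
  rw [finMem_seqCode hF h]
  constructor
  · rintro ⟨i', hi, h⟩
    obtain ⟨rfl, rfl⟩ := pair_inj.1 h
    exact ⟨hi, rfl⟩
  · rintro ⟨hi, rfl⟩
    exact ⟨i, hi, rfl⟩

theorem isFinSeq_seqCode {m n : N} {F : N → N} (hF : Def N F) (h : ∀ i < m, F i < n) :
    IsFinSeq m (seqCode m n F) := by
  refine ⟨isFinSet_setCode (def_seq hF) _, fun z hz => ?_, fun i hi => ⟨F i, ?_, fun j hj => ?_⟩⟩
  · obtain ⟨i, hi, rfl⟩ := (finMem_seqCode hF h).1 hz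
    exact ⟨i, F i, rfl, hi⟩
  · exact (pair_finMem_seqCode hF h).2 ⟨hi, rfl⟩
  · exact ((pair_finMem_seqCode hF h).1 hj).2

theorem IsFinSeq.exists_fun {c s : N} (h : IsFinSeq c s) :
    ∃ F, Def N F ∧ ∀ i x, FinMem (pair i x) s ↔ i < c ∧ x = F i := by
  obtain ⟨F, hF, hF'⟩ := exists_def (P := fun i x => i < c → FinMem (pair i x) s)
    (.imp (by fun_prop) (by fun_prop)) (fun i => by
      by_cases hi : i < c
      · obtain ⟨x, hx, -⟩ := h.2.2 i hi
        exact ⟨x, fun _ => hx⟩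
      · exact ⟨0, fun h => absurd h hi⟩)
  refine ⟨F, hF, fun i x => ⟨fun hx => ?_, ?_⟩⟩
  · obtain ⟨i', j, h1, hi⟩ := h.2.1 _ hx
    obtain ⟨rfl, rfl⟩ := pair_inj.1 h1
    exact ⟨hi, (h.2.2 i hi).unique hx (hF' i hi)⟩
  · rintro ⟨hi, rfl⟩
    exact hF' i hi

theorem Def.seqCode {m n : α → N} {F : α → N → N} (hm : Def N m) (hn : Def N n)
    (hF : Def N fun p : α × N => F p.1 p.2) : Def N fun a => seqCode (m a) (n a) (F a) := by
  refine Def.setCode (by fun_prop) (.bex (by fun_prop) (.eq (by fun_prop) (.numPair (by fun_prop)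
    ?_)))
  exact hF.comp₂ (by fun_prop) (by fun_prop)

/-- The code of the morphism that is given by an increasing function. -/
noncomputable def mor (m n : N) (F : N → N) : N := pair m (pair n (seqCode m n F))

theorem Def.mor {m n : α → N} {F : α → N → N} (hm : Def N m) (hn : Def N n)
    (hF : Def N fun p : α × N => F p.1 p.2) : Def N fun a => mor (m a) (n a) (F a) := by
  have := Def.seqCode hm hn hF
  unfold Model.mor
  fun_prop

section

variable {l m n : N} {F G H : N → N}

theorem mor_congr (h : ∀ i < m, F i = G i) : mor m n F = mor m n G := by
  unfold mor seqCode
  congr 3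
  ext z
  constructor <;> rintro ⟨i, hi, rfl⟩
  exacts [⟨i, hi, by rw [h i hi]⟩, ⟨i, hi, by rw [h i hi]⟩]

theorem app_mor (hF : IncFun m n F) {i j : N} : App (mor m n F) i j ↔ i < m ∧ j = F i := by
  rw [← pair_finMem_seqCode hF.isDef hF.lt]
  constructor
  · rintro ⟨m', n', s, h, h'⟩
    rw [mor, pair_inj, pair_inj] at h
    rwa [h.2.2]
  · exact fun h => ⟨_, _, _, rfl, h⟩

theorem IncFun.isMor (hF : IncFun m n F) : IsMor m n (mor m n F) := by
  refine ⟨_, rfl, isFinSeq_seqCode hF.isDef hF.lt, fun i j h => ?_, fun i i' j j' h h' hi => ?_⟩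
  · rw [pair_finMem_seqCode hF.isDef hF.lt] at h
    exact h.2 ▸ hF.lt i h.1
  · rw [pair_finMem_seqCode hF.isDef hF.lt] at h h'
    rw [h.2, h'.2]
    exact hF.mono _ _ hi h'.1

/-- By uniqueness of codes for finite sets, every morphism is literally the code of an increasing
function, so later arguments can use functions in place of codes. -/
theorem IsMor.exists_fun {f : N} (h : IsMor m n f) : ∃ F, IncFun m n F ∧ f = mor m n F := by
  obtain ⟨s, rfl, hs, h1, h2⟩ := h
  obtain ⟨F, hF, hF'⟩ := IsFinSeq.exists_fun hs
  have inc : IncFun m n F := ⟨hF, fun i hi => h1 i _ ((hF' i _).2 ⟨hi, rfl⟩), fun i j hij hj =>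
    h2 i j _ _ ((hF' i _).2 ⟨hij.trans hj, rfl⟩) ((hF' j _).2 ⟨hj, rfl⟩) hij⟩
  refine ⟨F, inc, ?_⟩
  rw [mor]
  congr 2
  have hs' := isFinSeq_seqCode (m := m) (n := n) hF inc.lt
  refine isFinSet_ext hs.1 hs'.1 fun z => ⟨fun hz => ?_, fun hz => ?_⟩
  · obtain ⟨i, j, rfl, -⟩ := hs.2.1 z hz
    exact (pair_finMem_seqCode hF inc.lt).2 ((hF' _ _).1 hz)
  · obtain ⟨i, j, rfl, -⟩ := hs'.2.1 z hz
    exact (hF' _ _).2 ((pair_finMem_seqCode hF inc.lt).1 hz)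

theorem isIncl_mor (hF : IncFun m n F) : IsIncl (mor m n F) ↔ ∀ i < m, F i = i := by
  simp only [IsIncl, app_mor hF]
  exact ⟨fun h i hi => h i _ ⟨hi, rfl⟩, fun h i j ⟨hi, hj⟩ => hj.trans (h i hi)⟩

theorem isComp_mor (hF : IncFun l m F) (hG : IncFun m n G) (hH : IncFun l n H) :
    IsComp (mor l m F) (mor m n G) (mor l n H) ↔ ∀ i < l, G (F i) = H i := by
  simp only [IsComp, app_mor hF, app_mor hG, app_mor hH]
  constructor
  · exact fun h i hi => (h i _ _ ⟨hi, rfl⟩ ⟨hF.lt i hi, rfl⟩).2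
  · rintro h i j k ⟨hi, rfl⟩ ⟨hj, rfl⟩
    exact ⟨hi, h i hi⟩

end

/-! ### Enumerations of finite sets -/

-- The value `cnt a k` is the number of elements of `a` below `k`.
open Classical in
theorem exists_count : ∃ cnt : N → N → N, Def N (fun p : N × N => cnt p.1 p.2) ∧
    (∀ a, cnt a 0 = 0) ∧ ∀ a k, cnt a (k + 1) = if FinMem k a then cnt a k + 1 else cnt a k :=
  exists_recursion (α := N) (g := fun _ => 0) (h := fun a k x => if FinMem k a then x + 1 else x)
    (by fun_prop) (.ite (by fun_prop) (by fun_prop) (by fun_prop))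

/-- The `i`-th element of `a` is the one with exactly `i` elements of `a` below it. The cardinality
is the count at `a` itself, since elements are smaller than the code. -/
theorem exists_enum : ∃ (card : N → N) (en : N → N → N), Def N card ∧
    Def N (fun p : N × N => en p.1 p.2) ∧ ∀ a, IncFun (card a) a (en a) ∧
      ∀ x, FinMem x a ↔ ∃ i < card a, en a i = x := by
  obtain ⟨cnt, hd, h0, hs⟩ := exists_count (N := N)
  have hd' : ∀ a, Def N (cnt a) := fun a => hd.section_right a
  have hin : ∀ a k, FinMem k a → cnt a (k + 1) = cnt a k + 1 := fun a k h => by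
    rw [hs, if_pos h]
  have hout : ∀ a k, ¬ FinMem k a → cnt a (k + 1) = cnt a k := fun a k h => by
    rw [hs, if_neg h]
  have mono : ∀ a j k : N, j ≤ k → cnt a j ≤ cnt a k := by
    intro a j
    refine def_induction (.imp (by fun_prop) (.le (by fun_prop) (hd.comp₂ (by fun_prop)
      (by fun_prop)))) ?_ ?_
    · intro hj
      rw [nonpos_iff_eq_zero.1 hj]
    · intro k ih hj
      rcases hj.lt_or_eq with hj | rfl
      · refine (ih (lt_succ_iff.1 hj)).trans ?_
        by_cases h : FinMem k a
        · rw [hin a k h]; exact le_self_add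
        · rw [hout a k h]
      · exact le_rfl
  have smono : ∀ a j k : N, FinMem j a → j < k → cnt a j < cnt a k := by
    intro a j k hj hjk
    refine lt_of_lt_of_le ?_ (mono a (j + 1) k (succ_le_iff.2 hjk))
    rw [hin a j hj]
    exact lt_succ_iff.2 le_rfl
  have surj : ∀ a k i : N, i < cnt a k → ∃ x < k, FinMem x a ∧ cnt a x = i := by
    intro a k i
    have hd'' := hd' a
    refine def_induction (P := fun k => i < cnt a k → ∃ x < k, FinMem x a ∧ cnt a x = i)
      (.imp (by fun_prop) (.bex (by fun_prop) (by fun_prop))) ?_ ?_ k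
    · intro h
      rw [h0] at h
      exact absurd h not_lt_zero
    · intro k ih hi
      by_cases hk : FinMem k a
      · rw [hin a k hk] at hi
        rcases (lt_succ_iff.1 hi).lt_or_eq with h | h
        · obtain ⟨x, hx, h'⟩ := ih h
          exact ⟨x, hx.trans_le le_self_add, h'⟩
        · exact ⟨k, lt_succ_iff.2 le_rfl, hk, h.symm⟩
      · rw [hout a k hk] at hi
        obtain ⟨x, hx, h'⟩ := ih hi
        exact ⟨x, hx.trans_le le_self_add, h'⟩
  obtain ⟨en, hen, hen'⟩ := exists_def (α := N × N)
    (P := fun p x => p.2 < cnt p.1 p.1 → x < p.1 ∧ FinMem x p.1 ∧ cnt p.1 x = p.2)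
    (by
      have h1 : Def N fun p : (N × N) × N => cnt p.1.1 p.1.1 := hd.comp₂ (by fun_prop) (by fun_prop)
      have h2 : Def N fun p : (N × N) × N => cnt p.1.1 p.2 := hd.comp₂ (by fun_prop) (by fun_prop)
      exact .imp (by fun_prop) (by fun_prop))
    (fun p => by
      by_cases h : p.2 < cnt p.1 p.1
      · obtain ⟨x, hx, hx'⟩ := surj _ _ _ h
        exact ⟨x, fun _ => ⟨hx, hx'⟩⟩
      · exact ⟨0, fun h' => absurd h' h⟩)
  refine ⟨fun a => cnt a a, fun a i => en (a, i), hd.comp₂ (by fun_prop) (by fun_prop), hen,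
    fun a => ⟨⟨hen.comp (by fun_prop), fun i hi => (hen' (a, i) hi).1, fun i j hij hj => ?_⟩,
      fun x => ⟨fun hx => ?_, ?_⟩⟩⟩
  · by_contra! h
    have := mono a _ _ h
    rw [(hen' (a, i) (hij.trans hj)).2.2, (hen' (a, j) hj).2.2] at this
    exact this.not_gt hij
  · have hlt : cnt a x < cnt a a := smono a x a hx hx.lt
    refine ⟨cnt a x, hlt, ?_⟩
    obtain ⟨h1, h2, h3⟩ := hen' (a, cnt a x) hlt
    rcases lt_trichotomy (en (a, cnt a x)) x with h | h | h
    · exact absurd h3 (smono _ _ _ h2 h).ne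
    · exact h
    · exact absurd h3 (smono _ _ _ hx h).ne'
  · rintro ⟨i, hi, rfl⟩
    exact (hen' (a, i) hi).2.1

/-- The cardinality of a finite set. -/
noncomputable def card : N → N := exists_enum.choose

/-- The increasing enumeration of a finite set. -/
noncomputable def en : N → N → N := exists_enum.choose_spec.choose

@[fun_prop]
theorem Def.card {f : α → N} (hf : Def N f) : Def N fun a => card (f a) :=
  Def.comp exists_enum.choose_spec.choose_spec.1 hf

@[fun_prop]
theorem Def.en {f g : α → N} (hf : Def N f) (hg : Def N g) : Def N fun a => en (f a) (g a) :=
  exists_enum.choose_spec.choose_spec.2.1.comp₂ hf hg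

theorem incFun_en (a : N) : IncFun (card a) a (en a) :=
  (exists_enum.choose_spec.choose_spec.2.2 a).1

theorem finMem_iff_en {a x : N} : FinMem x a ↔ ∃ i < card a, en a i = x :=
  (exists_enum.choose_spec.choose_spec.2.2 a).2 x

theorem finMem_en {a i : N} (hi : i < card a) : FinMem (en a i) a := finMem_iff_en.2 ⟨i, hi, rfl⟩

theorem incFun_en_of {a n : N} (h : ∀ x : N, FinMem x a → x < n) : IncFun (card a) n (en a) :=
  (incFun_en a).cod fun _ hi => h _ (finMem_en hi)

theorem isEnum_seqCode {a : N} (ha : IsFinSet a) :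
    IsEnum (fun x y => x < y) a (card a) (seqCode (card a) a (en a)) := by
  have h := incFun_en a
  refine ⟨ha, isFinSeq_seqCode h.isDef h.lt, fun x => ?_, fun i i' x x' hi hi' hii' => ?_⟩
  · rw [finMem_iff_en]
    simp only [pair_finMem_seqCode h.isDef h.lt, eq_comm]
  · rw [pair_finMem_seqCode h.isDef h.lt] at hi hi'
    rw [hi.2, hi'.2]
    exact h.mono _ _ hii' hi'.1

theorem IsEnum.unique {a c s : N} (h : IsEnum (fun x y => x < y) a c s) :
    c = card a ∧ ∀ i x, FinMem (pair i x) s ↔ i < card a ∧ x = en a i := by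
  obtain ⟨ha, hs, h1, h2⟩ := h
  obtain ⟨F, hF, hF'⟩ := IsFinSeq.exists_fun hs
  have inc : IncFun c a F := by
    refine ⟨hF, fun i hi => ?_, fun i j hij hj => ?_⟩
    · exact ((h1 _).2 ⟨i, (hF' i _).2 ⟨hi, rfl⟩⟩).lt
    · exact h2 i j _ _ ((hF' i _).2 ⟨hij.trans hj, rfl⟩) ((hF' j _).2 ⟨hj, rfl⟩) hij
  obtain ⟨hc, hc'⟩ := inc.eq_of_range (incFun_en a)
    (fun i hi => finMem_iff_en.1 ((h1 _).2 ⟨i, (hF' i _).2 ⟨hi, rfl⟩⟩))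
    (fun j hj => by
      obtain ⟨i, hi⟩ := (h1 _).1 (finMem_en hj)
      rw [hF'] at hi
      exact ⟨i, hi.1, hi.2.symm⟩)
  refine ⟨hc, fun i x => ?_⟩
  rw [hF', ← hc]
  exact and_congr_right fun hi => by rw [hc' i hi]

theorem isCard_iff {a c : N} (ha : IsFinSet a) : IsCard (fun x y => x < y) a c ↔ c = card a :=
  ⟨fun ⟨_, h⟩ => (IsEnum.unique h).1, fun h => ⟨_, h ▸ isEnum_seqCode ha⟩⟩

theorem isInclMor_iff {a b f : N} (ha : IsFinSet a) (hb : IsFinSet b) :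
    IsInclMor (fun x y => x < y) a b f ↔ ∃ H, IncFun (card a) (card b) H ∧
      f = mor (card a) (card b) H ∧ ∀ i < card a, en b (H i) = en a i := by
  constructor
  · rintro ⟨c, d, s, t, h1, h2, h3, h4⟩
    obtain ⟨rfl, hs⟩ := IsEnum.unique h1
    obtain ⟨rfl, ht⟩ := IsEnum.unique h2
    obtain ⟨H, hH, rfl⟩ := IsMor.exists_fun h3
    refine ⟨H, hH, rfl, fun i hi => ?_⟩
    simp only [app_mor hH, hs, ht] at h4
    exact (h4 i (H i) (en a i) ⟨hi, rfl⟩ ⟨hi, rfl⟩).2.symm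
  · rintro ⟨H, hH, rfl, h⟩
    refine ⟨_, _, _, _, isEnum_seqCode ha, isEnum_seqCode hb, hH.isMor, ?_⟩
    simp only [app_mor hH, pair_finMem_seqCode (incFun_en _).isDef (incFun_en _).lt]
    rintro i _ _ ⟨hi, rfl⟩ ⟨-, rfl⟩
    exact ⟨hH.lt i hi, (h i hi).symm⟩

end Morphisms
/-! ### Goodstein dilators -/

section Dilator

variable {N : Type u} [Model N] {α : Type v} [Cod N α] {D : Set N}

@[fun_prop]
theorem Def.objMem (hD : D ∈ sets (N := N)) {f g : α → N} (hf : Def N f) (hg : Def N g) :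
    Def N fun a => ObjMem D (f a) (g a) := by
  unfold ObjMem; fun_prop (disch := assumption)

@[fun_prop]
theorem Def.mapTo (hD : D ∈ sets (N := N)) {f g h : α → N} (hf : Def N f) (hg : Def N g)
    (hh : Def N h) : Def N fun a => MapTo D (f a) (g a) (h a) := by
  unfold MapTo; fun_prop (disch := assumption)

/-- The code of the inclusion of a finite set `a` into `{0,…,n-1}`. -/
noncomputable def inc (n a : N) : N := mor (card a) n (en a)

@[fun_prop]
theorem Def.inc {f g : α → N} (hf : Def N f) (hg : Def N g) : Def N fun a => inc (f a) (g a) :=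
  Def.mor (by fun_prop) hf (by fun_prop)

variable {k l m n m' σ τ ρ σ' τ' : N} {F G H : N → N}

section Functor

variable (hD : IsFunctor D)
include hD

theorem exists_mapTo (hF : IncFun m n F) (hσ : ObjMem D m σ) : ∃ τ, MapTo D (mor m n F) σ τ :=
  (hD.map_total m n _ σ hF.isMor hσ).exists

theorem mapTo_dom (hF : IncFun m n F) (h : MapTo D (mor m n F) σ τ) : ObjMem D m σ :=
  (hD.map_mem m n _ σ τ hF.isMor h).1

theorem mapTo_cod (hF : IncFun m n F) (h : MapTo D (mor m n F) σ τ) : ObjMem D n τ :=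
  (hD.map_mem m n _ σ τ hF.isMor h).2

theorem mapTo_unique (hF : IncFun m n F) (h : MapTo D (mor m n F) σ τ)
    (h' : MapTo D (mor m n F) σ τ') : τ = τ' :=
  (hD.map_total m n _ σ hF.isMor (mapTo_dom hD hF h)).unique h h'

theorem mapTo_comp (hF : IncFun l m F) (hG : IncFun m n G) (hH : IncFun l n H)
    (h : ∀ i < l, G (F i) = H i) (h1 : MapTo D (mor l m F) σ τ) (h2 : MapTo D (mor m n G) τ ρ) :
    MapTo D (mor l n H) σ ρ :=
  hD.map_comp l m n _ _ _ σ τ ρ hF.isMor hG.isMor hH.isMor ((isComp_mor hF hG hH).2 h) h1 h2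

theorem mapTo_of_comp (hF : IncFun l m F) (hG : IncFun m n G) (hH : IncFun l n H)
    (h : ∀ i < l, G (F i) = H i) (h1 : MapTo D (mor l m F) σ τ) (h2 : MapTo D (mor l n H) σ ρ) :
    MapTo D (mor m n G) τ ρ := by
  obtain ⟨ρ', h3⟩ := exists_mapTo hD hG (mapTo_cod hD hF h1)
  have h4 := mapTo_comp hD hF hG hH h h1 h3
  rwa [mapTo_unique hD hH h2 h4]

theorem mapTo_id (hσ : ObjMem D n σ) : MapTo D (mor n n fun i => i) σ σ :=
  hD.map_id n _ σ (IncFun.id le_rfl).isMor ((isIncl_mor (IncFun.id le_rfl)).2 fun _ _ => rfl) hσ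

/-- An element in the range of `D(F)` lies in the range of `D(G)`, if `G` has larger range. -/
theorem mapTo_of_range (hF : IncFun m n F) (hG : IncFun l n G)
    (h : ∀ i < m, ∃ j < l, G j = F i) (h1 : MapTo D (mor m n F) σ τ) :
    ∃ ρ, MapTo D (mor l n G) ρ τ := by
  obtain ⟨H, hH, hH'⟩ := hF.exists_factor hG h
  obtain ⟨ρ, hρ⟩ := exists_mapTo hD hH (mapTo_dom hD hF h1)
  exact ⟨ρ, mapTo_of_comp hD hH hG hF hH' hρ h1⟩

end Functor

section Goodstein

variable (hDS : D ∈ sets (N := N)) (hD : IsGoodsteinDilator sets D)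
include hD

theorem mapTo_lt (hF : IncFun m n F) (h : MapTo D (mor m n F) σ τ)
    (h' : MapTo D (mor m n F) σ' τ') (hlt : σ < σ') : τ < τ' :=
  (hD.usual_order n _ _ (mapTo_cod hD.1 hF h) (mapTo_cod hD.1 hF h')).1
    (hD.1.map_lt m n _ _ _ _ _ hF.isMor h h'
      ((hD.usual_order m _ _ (mapTo_dom hD.1 hF h) (mapTo_dom hD.1 hF h')).2 hlt))

theorem mapTo_le (hF : IncFun m n F) (h : MapTo D (mor m n F) σ τ)
    (h' : MapTo D (mor m n F) σ' τ') (hle : σ ≤ σ') : τ ≤ τ' := by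
  rcases hle.lt_or_eq with hlt | rfl
  · exact (mapTo_lt hD hF h h' hlt).le
  · exact (mapTo_unique hD.1 hF h h').le

theorem lt_of_mapTo_lt (hF : IncFun m n F) (h : MapTo D (mor m n F) σ τ)
    (h' : MapTo D (mor m n F) σ' τ') (hlt : τ < τ') : σ < σ' := by
  by_contra! hle
  exact (mapTo_le hD hF h' h hle).not_gt hlt

theorem mapTo_injective (hF : IncFun m n F) (h : MapTo D (mor m n F) σ τ)
    (h' : MapTo D (mor m n F) σ' τ) : σ = σ' := by
  rcases lt_trichotomy σ σ' with hlt | heq | hlt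
  · exact absurd (mapTo_lt hD hF h h' hlt) (lt_irrefl _)
  · exact heq
  · exact absurd (mapTo_lt hD hF h' h hlt) (lt_irrefl _)

/-- The empty map into `n` factors through `m`, and both empty maps send 0 to 0. -/
theorem mapTo_zero (hF : IncFun m n F) : MapTo D (mor m n F) 0 0 := by
  have h : ∀ n : N, IncFun 0 n fun i => i := fun n => IncFun.id zero_le
  exact mapTo_of_comp hD.1 (h m) hF (h n) (fun i hi => absurd hi not_lt_zero)
    (hD.map_zero m _ (h m).isMor) (hD.map_zero n _ (h n).isMor)

include hDS in
-- `D(F)` is strictly increasing on an initial segment of the numbers, so it dominates the identity.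
-- This bounds the search for preimages in `supp`.
theorem le_of_mapTo (hF : IncFun m n F) (h : MapTo D (mor m n F) σ τ) : σ ≤ τ := by
  obtain ⟨T, hT, hT'⟩ := exists_def (P := fun σ τ => ObjMem D m σ → MapTo D (mor m n F) σ τ)
    (.imp (by fun_prop (disch := assumption)) (by fun_prop (disch := assumption))) (fun σ => by
      by_cases hσ : ObjMem D m σ
      · obtain ⟨τ, hτ⟩ := exists_mapTo hD.1 hF hσ
        exact ⟨τ, fun _ => hτ⟩
      · exact ⟨0, fun h => absurd h hσ⟩)
  have key : ∀ σ, ObjMem D m σ → σ ≤ T σ := by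
    refine def_induction (P := fun σ => ObjMem D m σ → σ ≤ T σ)
      (.imp (by fun_prop (disch := assumption)) (by fun_prop)) (fun _ => zero_le) ?_
    intro σ ih hσ
    have hlt : σ < σ + 1 := lt_succ_iff.2 le_rfl
    have hσ' := hD.initial m _ _ hσ hlt
    exact succ_le_iff.2 ((ih hσ').trans_lt (mapTo_lt hD hF (hT' _ hσ') (hT' _ hσ) hlt))
  have hσ := mapTo_dom hD.1 hF h
  rw [mapTo_unique hD.1 hF h (hT' σ hσ)]
  exact key σ hσ

/-- Preservation of pullbacks, in terms of ranges. -/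
theorem exists_mapTo_of_inter (hF : IncFun m n F) (hG : IncFun m' n G) (hH : IncFun l n H)
    (hr : ∀ x, (∃ i < l, H i = x) ↔ (∃ i < m, F i = x) ∧ ∃ i < m', G i = x)
    (h1 : MapTo D (mor m n F) σ τ) (h2 : MapTo D (mor m' n G) σ' τ) :
    ∃ ρ, MapTo D (mor l n H) ρ τ := by
  obtain ⟨P, hP, hP'⟩ := hH.exists_factor hF fun i hi => ((hr _).1 ⟨i, hi, rfl⟩).1
  obtain ⟨Q, hQ, hQ'⟩ := hH.exists_factor hG fun i hi => ((hr _).1 ⟨i, hi, rfl⟩).2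
  -- Maps that agree after `F` and `G` have a common composite with range in the intersection, so
  -- this composite factors through `H`.
  have pb : IsNatPullback l m m' n (mor l m P) (mor l m' Q) (mor m n F) (mor m' n G) := by
    refine ⟨hP.isMor, hQ.isMor, hF.isMor, hG.isMor,
      ⟨_, hH.isMor, (isComp_mor hP hF hH).2 hP', (isComp_mor hQ hG hH).2 hQ'⟩, ?_⟩
    rintro k j j' hj hj' ⟨d, hd, hjd, hjd'⟩
    obtain ⟨J, hJ, rfl⟩ := IsMor.exists_fun hj
    obtain ⟨J', hJ', rfl⟩ := IsMor.exists_fun hj'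
    obtain ⟨E, hE, rfl⟩ := IsMor.exists_fun hd
    rw [isComp_mor hJ hF hE] at hjd
    rw [isComp_mor hJ' hG hE] at hjd'
    obtain ⟨K, hK, hK'⟩ := hE.exists_factor hH fun i hi =>
      (hr _).2 ⟨⟨_, hJ.lt i hi, hjd i hi⟩, ⟨_, hJ'.lt i hi, hjd' i hi⟩⟩
    refine ⟨mor k l K, ⟨hK.isMor, (isComp_mor hK hP hJ).2 fun i hi => ?_,
      (isComp_mor hK hQ hJ').2 fun i hi => ?_⟩, ?_⟩
    · refine hF.inj (hP.lt _ (hK.lt i hi)) (hJ.lt i hi) ?_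
      rw [hP' _ (hK.lt i hi), hK' i hi, hjd i hi]
    · refine hG.inj (hQ.lt _ (hK.lt i hi)) (hJ'.lt i hi) ?_
      rw [hQ' _ (hK.lt i hi), hK' i hi, hjd' i hi]
    · rintro h ⟨hh, hh1, -⟩
      obtain ⟨K', hK1, rfl⟩ := IsMor.exists_fun hh
      rw [isComp_mor hK1 hP hJ] at hh1
      refine mor_congr fun i hi => hH.inj (hK1.lt i hi) (hK.lt i hi) ?_
      rw [hK' i hi, ← hP' _ (hK1.lt i hi), hh1 i hi, hjd i hi]
  -- The pullback property is tested on the one-point order: its embeddings are elements, so `σ` and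
  -- `σ'` have a common preimage.
  have single : ∀ x : N, {z : N | z = x} ∈ sets := fun x => Def.mem_sets (by fun_prop)
  have hL : ∀ x, OrdMem {z : N | z = pair 0 0} x ↔ x = 0 := fun x => by
    simp [OrdMem, pair_inj]
  have hL' : ∀ x y, ¬ OrdLt {z : N | z = pair 0 0} x y := fun x y => by
    simp [OrdLt, pair_inj]
  have emb : ∀ {m σ : N}, ObjMem D m σ → IsEmb (OrdMem {z : N | z = pair 0 0})
      (OrdLt {z : N | z = pair 0 0}) (ObjMem D m) (ObjLt D m) {z : N | z = pair 0 σ} := by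
    intro m σ hσ
    refine ⟨?_, fun x hx => ?_, fun x x' _ _ _ _ h => absurd h (hL' _ _)⟩
    · rintro z rfl
      exact ⟨0, σ, rfl, (hL 0).2 rfl, hσ⟩
    · rw [hL] at hx
      subst hx
      exact ⟨σ, rfl, fun y hy => (pair_inj.1 hy).2⟩
  obtain ⟨K, ⟨-, hK, hK1, -⟩, -⟩ := hD.preserves_pullbacks _ _ _ _ _ _ _ _ pb _
    (single (pair 0 0))
    ⟨fun x y h => absurd h (hL' x y), fun x => hL' x x, fun x y z h => absurd h (hL' x y),
      fun x y hx hy => .inr (.inl (by rw [hL] at hx hy; rw [hx, hy]))⟩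
    _ (single (pair 0 σ)) _ (single (pair 0 σ')) (emb (mapTo_dom hD.1 hF h1))
    (emb (mapTo_dom hD.1 hG h2)) (by
      rintro x y y' τ' hxy hxy'
      obtain ⟨-, rfl⟩ := pair_inj.1 hxy
      obtain ⟨-, rfl⟩ := pair_inj.1 hxy'
      constructor
      · intro h
        rwa [← mapTo_unique hD.1 hF h1 h]
      · intro h
        rwa [← mapTo_unique hD.1 hG h2 h])
  obtain ⟨ρ, hρ, -⟩ := hK.2.1 0 ((hL 0).2 rfl)
  exact ⟨ρ, mapTo_comp hD.1 hP hF hH hP' (hK1 0 ρ σ hρ rfl) h1⟩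

end Goodstein

/-! ### Supports -/

/-- The finite set `{0,…,n-1} \ {i}`. -/
noncomputable def skip (n i : N) : N := setCode n fun x => x ≠ i

theorem def_ne (i : N) : Def N fun x => x ≠ i := by
  unfold Ne; fun_prop

@[fun_prop]
theorem Def.skip {f g : α → N} (hf : Def N f) (hg : Def N g) : Def N fun a => skip (f a) (g a) :=
  Def.setCode hf (.not (by fun_prop))

theorem finMem_skip {n i x : N} : FinMem x (skip n i) ↔ x < n ∧ x ≠ i := finMem_setCode (def_ne i)

theorem incFun_skip (n i : N) : IncFun (card (skip n i)) n (en (skip n i)) :=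
  incFun_en_of fun _ hx => (finMem_skip.1 hx).1

theorem exists_en_skip {n i x : N} : (∃ j < card (skip n i), en (skip n i) j = x) ↔
    x < n ∧ x ≠ i := by
  rw [← finMem_iff_en, finMem_skip]

theorem exists_en_setCode {P : N → Prop} (hP : Def N P) {n x : N} :
    (∃ j < card (setCode n P), en (setCode n P) j = x) ↔ x < n ∧ P x := by
  rw [← finMem_iff_en, finMem_setCode hP]

/-- The least finite set `a` such that `σ` lies in the range of `D(inc n a)`. -/
noncomputable def supp (D : Set N) (n σ : N) : N :=
  setCode n fun i => ¬ ∃ ρ < σ + 1, MapTo D (inc n (skip n i)) ρ σ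

section Support

variable (hDS : D ∈ sets (N := N)) (hD : IsGoodsteinDilator sets D)
include hDS

theorem Def.supp {f g : α → N} (hf : Def N f) (hg : Def N g) : Def N fun a => supp D (f a) (g a) :=
  Def.setCode hf (.not (.bex (by fun_prop) (by fun_prop (disch := assumption))))

theorem def_supp_pred (n σ : N) :
    Def N fun i => ¬ ∃ ρ < σ + 1, MapTo D (inc n (skip n i)) ρ σ :=
  .not (.bex (by fun_prop) (by fun_prop (disch := assumption)))

theorem isFinSet_supp (n σ : N) : IsFinSet (supp D n σ) :=
  isFinSet_setCode (def_supp_pred hDS n σ) n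

include hD

theorem finMem_supp {n σ i : N} : FinMem i (supp D n σ) ↔ i < n ∧
    ¬ ∃ ρ, MapTo D (inc n (skip n i)) ρ σ := by
  rw [supp, finMem_setCode (def_supp_pred hDS n σ)]
  refine and_congr_right fun _ => not_congr ⟨fun ⟨ρ, _, h⟩ => ⟨ρ, h⟩, fun ⟨ρ, h⟩ => ⟨ρ, ?_, h⟩⟩
  exact lt_succ_iff.2 (le_of_mapTo hDS hD (incFun_skip n i) h)

/-- Points outside the range of `F` are discarded one at a time. By induction on `k`, the value `σ`
comes from the set of all `i < n` that are in the range of `F` or at least `k`; this is everything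
for `k = 0` and the range itself for `k = n`. When a point leaves this set it is not in the support,
so the smaller set is an intersection to which the pullback property applies. -/
theorem exists_mapTo_of_supp (hF : IncFun m n F) (hσ : ObjMem D n σ)
    (h : ∀ j, FinMem j (supp D n σ) → ∃ i < m, F i = j) : ∃ ρ, MapTo D (mor m n F) ρ σ := by
  have hFd := hF.isDef
  have hd : ∀ k, Def N fun i => (∃ j < m, F j = i) ∨ k ≤ i := fun k =>
    .or (.bex (by fun_prop) (by fun_prop)) (by fun_prop)
  have hi : ∀ k, IncFun (card (setCode n fun i => (∃ j < m, F j = i) ∨ k ≤ i)) n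
      (en (setCode n fun i => (∃ j < m, F j = i) ∨ k ≤ i)) := fun k =>
    incFun_en_of fun x hx => ((finMem_setCode (hd k)).1 hx).1
  have key : ∀ k, ∃ ρ, MapTo D (inc n (setCode n fun i => (∃ j < m, F j = i) ∨ k ≤ i)) ρ σ := by
    refine sigma_induction (P := fun k ρ =>
      MapTo D (inc n (setCode n fun i => (∃ j < m, F j = i) ∨ k ≤ i)) ρ σ) ?_ ?_ ?_
    · refine .mapTo hDS (.inc (by fun_prop) (.setCode (by fun_prop) (.or (.bex (by fun_prop)
        (by fun_prop)) (by fun_prop)))) (by fun_prop) (by fun_prop)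
    · refine mapTo_of_range hD.1 (IncFun.id le_rfl) (hi 0) (fun i hi => ?_) (mapTo_id hD.1 hσ)
      exact (exists_en_setCode (hd 0)).2 ⟨hi, .inr zero_le⟩
    · rintro k ⟨ρ, hρ⟩
      -- In this case the set for `k + 1` already contains the set for `k`: either `k` lies in the
      -- range of `F`, or it is not below `n`.
      by_cases hk : FinMem k (supp D n σ) ∨ n ≤ k
      · refine mapTo_of_range hD.1 (hi k) (hi (k + 1)) (fun i hi' => ?_) hρ
        rw [exists_en_setCode (hd _)]
        obtain ⟨h1, h2⟩ := (exists_en_setCode (hd k)).1 ⟨i, hi', rfl⟩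
        refine ⟨h1, h2.elim .inl fun h2 => ?_⟩
        rcases h2.lt_or_eq with h2 | h2
        · exact .inr (succ_le_iff.2 h2)
        · rcases hk with hk | hk
          · exact .inl (h2 ▸ h k hk)
          · exact absurd h1 (not_lt.2 (h2 ▸ hk))
      · push Not at hk
        rw [finMem_supp hDS hD] at hk
        obtain ⟨ρ', hρ'⟩ : ∃ ρ, MapTo D (inc n (skip n k)) ρ σ := by
          by_contra h'
          exact hk.1 ⟨hk.2, h'⟩
        by_cases hkF : ∃ j < m, F j = k
        · refine mapTo_of_range hD.1 (hi k) (hi (k + 1)) (fun i hi' => ?_) hρ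
          rw [exists_en_setCode (hd _)]
          obtain ⟨h1, h2⟩ := (exists_en_setCode (hd k)).1 ⟨i, hi', rfl⟩
          refine ⟨h1, h2.elim .inl fun h2 => ?_⟩
          rcases h2.lt_or_eq with h2 | h2
          · exact .inr (succ_le_iff.2 h2)
          · exact .inl (h2 ▸ hkF)
        · refine exists_mapTo_of_inter hD (hi k) (incFun_skip n k) (hi (k + 1)) (fun x => ?_) hρ hρ'
          rw [exists_en_setCode (hd _), exists_en_setCode (hd _), exists_en_skip, succ_le_iff,
            lt_iff_le_and_ne (a := k)]
          constructor
          · rintro ⟨h1, h2 | h2⟩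
            · exact ⟨⟨h1, .inl h2⟩, h1, fun h3 => hkF (h3 ▸ h2)⟩
            · exact ⟨⟨h1, .inr h2.1⟩, h1, h2.2.symm⟩
          · rintro ⟨⟨h1, h2⟩, -, h3⟩
            exact ⟨h1, h2.imp_right fun h2 => ⟨h2, h3.symm⟩⟩
  obtain ⟨ρ, hρ⟩ := key n
  refine mapTo_of_range hD.1 (hi n) hF (fun i hi' => ?_) hρ
  obtain ⟨h1, h2⟩ := (exists_en_setCode (hd n)).1 ⟨i, hi', rfl⟩
  exact h2.resolve_right (not_le.2 h1)

/-- Points outside the range of `F` are avoidable for `τ`, and a point avoidable for `σ` has an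
avoidable image. Conversely, if `F i` is avoidable for `τ`, intersecting the range of `F` with its
complement gives a preimage of `τ` that avoids `i`; injectivity of `D(F)` transfers this to `σ`. -/
theorem finMem_supp_mapTo (hF : IncFun m n F) (h : MapTo D (mor m n F) σ τ) (j : N) :
    FinMem j (supp D n τ) ↔ ∃ i < m, FinMem i (supp D m σ) ∧ F i = j := by
  constructor
  · intro hj
    rw [finMem_supp hDS hD] at hj
    obtain ⟨i, hi, rfl⟩ : ∃ i < m, F i = j := by
      by_contra! h'
      exact hj.2 (mapTo_of_range hD.1 hF (incFun_skip n j) (fun i hi => exists_en_skip.2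
        ⟨hF.lt i hi, h' i hi⟩) h)
    refine ⟨i, hi, (finMem_supp hDS hD).2 ⟨hi, fun ⟨ρ, hρ⟩ => hj.2 ?_⟩, rfl⟩
    have hs := incFun_skip m i
    refine mapTo_of_range hD.1 (hF.comp hs) (incFun_skip n (F i)) (fun x hx => exists_en_skip.2
      ⟨(hF.comp hs).lt x hx, fun h' => ?_⟩)
      (mapTo_comp hD.1 hs hF (hF.comp hs) (fun _ _ => rfl) hρ h)
    exact (exists_en_skip.1 ⟨x, hx, rfl⟩).2 (hF.inj (hs.lt x hx) hi h')
  · rintro ⟨i, hi, hi', rfl⟩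
    rw [finMem_supp hDS hD] at hi' ⊢
    refine ⟨hF.lt i hi, fun ⟨ρ, hρ⟩ => hi'.2 ?_⟩
    have hs := incFun_skip m i
    obtain ⟨ρ', hρ'⟩ := exists_mapTo_of_inter hD hF (incFun_skip n (F i)) (hF.comp hs)
      (fun x => by
        rw [exists_en_skip]
        constructor
        · rintro ⟨y, hy, rfl⟩
          exact ⟨⟨_, hs.lt y hy, rfl⟩, (hF.comp hs).lt y hy, fun h' =>
            (exists_en_skip.1 ⟨y, hy, rfl⟩).2 (hF.inj (hs.lt y hy) hi h')⟩
        · rintro ⟨⟨y, hy, rfl⟩, h1, h2⟩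
          obtain ⟨z, hz, hz'⟩ := exists_en_skip.2 ⟨hy, fun h' : y = i => h2 (h' ▸ rfl)⟩
          exact ⟨z, hz, congrArg F hz'⟩) h hρ
    obtain ⟨σ', hσ'⟩ := exists_mapTo hD.1 hs (mapTo_dom hD.1 (hF.comp hs) hρ')
    have := mapTo_of_comp hD.1 hs hF (hF.comp hs) (fun _ _ => rfl) hσ' hρ'
    rw [mapTo_injective hD hF h this]
    exact ⟨ρ', hσ'⟩

theorem exists_isSupport : ∃ U ∈ sets (N := N), IsSupport D U := by
  have hd : Def N fun z : N => ∃ n < z + 1, ∃ σ < z + 1, z = pair n (pair σ (supp D n σ)) :=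
    .bex (by fun_prop) (.bex (by fun_prop) (.eq (by fun_prop) (.numPair (by fun_prop)
      (.numPair (by fun_prop) (.supp hDS (by fun_prop) (by fun_prop))))))
  have hU : ∀ n σ a, SuppTo {z : N | ∃ n < z + 1, ∃ σ < z + 1, z = pair n (pair σ (supp D n σ))}
      n σ a ↔ a = supp D n σ := by
    intro n σ a
    constructor
    · rintro ⟨n', -, σ', -, h⟩
      rw [pair_inj, pair_inj] at h
      obtain ⟨rfl, rfl, h⟩ := h
      exact h
    · rintro rfl
      exact ⟨n, left_lt_pair_succ _ _, σ,
        lt_succ_iff.2 ((left_le_pair _ _).trans (right_le_pair _ _)), rfl⟩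
  refine ⟨_, hd.mem_sets, ⟨?_, ?_, ?_, ?_⟩⟩ <;> simp only [hU]
  · exact fun n σ _ => ⟨_, rfl, fun _ h => h⟩
  · rintro n σ _ - rfl
    exact ⟨isFinSet_supp hDS n σ, fun i hi => ((finMem_supp hDS hD).1 hi).1⟩
  · rintro m n f σ τ _ _ hf h rfl rfl j
    obtain ⟨F, hF, rfl⟩ := IsMor.exists_fun hf
    simp only [finMem_supp_mapTo hDS hD hF h j, app_mor hF]
    exact ⟨fun ⟨i, h1, h2, h3⟩ => ⟨i, h2, h1, h3.symm⟩, fun ⟨i, h1, h2, h3⟩ => ⟨i, h2, h1, h3.symm⟩⟩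
  · rintro m n f σ _ hf hσ rfl h
    obtain ⟨F, hF, rfl⟩ := IsMor.exists_fun hf
    refine exists_mapTo_of_supp hDS hD hF hσ fun j hj => ?_
    obtain ⟨i, hi⟩ := h j hj
    rw [app_mor hF] at hi
    exact ⟨i, hi.1, hi.2.symm⟩

end Support

end Dilator
/-! ### The extension to the natural numbers -/

section Extension

variable {N : Type u} [Model N] {D U : Set N} {n a b σ τ σ' τ' : N}

theorem def_finMem_or (a b : N) : Def N fun x => FinMem x a ∨ FinMem x b := by fun_prop

theorem exists_union (a b : N) : ∃ u, IsUnion a b u := by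
  refine ⟨setCode (a + b) fun x => FinMem x a ∨ FinMem x b,
    isFinSet_setCode (def_finMem_or a b) _, fun x => ?_⟩
  rw [finMem_setCode (def_finMem_or a b), and_iff_right_iff_imp]
  rintro (h | h)
  exacts [h.lt.trans_le le_self_add, h.lt.trans_le le_add_self]

/-- The order on the extension, computed in a common codomain. -/
theorem extLt_iff (hD : IsGoodsteinDilator sets D) (ha : IsFinSet a) (hb : IsFinSet b)
    (han : ∀ x, FinMem x a → x < n) (hbn : ∀ x, FinMem x b → x < n)
    (h : MapTo D (inc n a) σ σ') (h' : MapTo D (inc n b) τ τ') :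
    ExtLt D (fun x y => x < y) (pair a σ) (pair b τ) ↔ σ' < τ' := by
  have hA := incFun_en_of han
  have hB := incFun_en_of hbn
  have hU : ∀ {u}, IsUnion a b u → IncFun (card u) n (en u) := fun hu =>
    incFun_en_of fun x hx => ((hu.2 x).1 hx).elim (han x) (hbn x)
  constructor
  · rintro ⟨a', σ₀, b', τ₀, u, d, f, g, σ₁, τ₁, h1, h2, hu, hd, hf, hg, hσ, hτ, hlt⟩
    obtain ⟨rfl, rfl⟩ := pair_inj.1 h1
    obtain ⟨rfl, rfl⟩ := pair_inj.1 h2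
    obtain rfl := (isCard_iff hu.1).1 hd
    obtain ⟨F, hF, rfl, hF'⟩ := (isInclMor_iff ha hu.1).1 hf
    obtain ⟨G, hG, rfl, hG'⟩ := (isInclMor_iff hb hu.1).1 hg
    rw [hD.usual_order _ _ _ (mapTo_cod hD.1 hF hσ) (mapTo_cod hD.1 hG hτ)] at hlt
    -- The enumeration of the union, viewed as a map into `n`, carries the values in `D(|a ∪ b|)` to
    -- `σ'` and `τ'`.
    exact mapTo_lt hD (hU hu) (mapTo_of_comp hD.1 hF (hU hu) hA hF' hσ h)
      (mapTo_of_comp hD.1 hG (hU hu) hB hG' hτ h') hlt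
  · intro hlt
    obtain ⟨u, hu⟩ := exists_union a b
    obtain ⟨F, hF, hF'⟩ := hA.exists_factor (hU hu) fun i hi =>
      finMem_iff_en.1 ((hu.2 _).2 (.inl (finMem_en hi)))
    obtain ⟨G, hG, hG'⟩ := hB.exists_factor (hU hu) fun i hi =>
      finMem_iff_en.1 ((hu.2 _).2 (.inr (finMem_en hi)))
    obtain ⟨σ₁, hσ⟩ := exists_mapTo hD.1 hF (mapTo_dom hD.1 hA h)
    obtain ⟨τ₁, hτ⟩ := exists_mapTo hD.1 hG (mapTo_dom hD.1 hB h')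
    refine ⟨a, σ, b, τ, u, card u, _, _, σ₁, τ₁, rfl, rfl, hu, (isCard_iff hu.1).2 rfl,
      (isInclMor_iff ha hu.1).2 ⟨F, hF, rfl, hF'⟩, (isInclMor_iff hb hu.1).2 ⟨G, hG, rfl, hG'⟩,
      hσ, hτ, ?_⟩
    rw [hD.usual_order _ _ _ (mapTo_cod hD.1 hF hσ) (mapTo_cod hD.1 hG hτ)]
    exact lt_of_mapTo_lt hD (hU hu) (mapTo_of_comp hD.1 hF (hU hu) hA hF' hσ h)
      (mapTo_of_comp hD.1 hG (hU hu) hB hG' hτ h') hlt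

/-- Every element of `D(n)` comes from an element of the extension. -/
theorem exists_extMem (hU : IsSupport D U) (hσ : ObjMem D n σ) :
    ∃ a ρ, SuppTo U n σ a ∧ MapTo D (inc n a) ρ σ := by
  obtain ⟨a, ha, -⟩ := hU.total n σ hσ
  obtain ⟨-, h2⟩ := hU.finSubset n σ a hσ ha
  have hA := incFun_en_of h2
  obtain ⟨ρ, hρ⟩ := hU.range _ n _ σ a hA.isMor hσ ha fun j hj => by
    obtain ⟨i, hi, rfl⟩ := finMem_iff_en.1 hj
    exact ⟨i, (app_mor hA).2 ⟨hi, rfl⟩⟩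
  exact ⟨a, ρ, ha, hρ⟩

/-- By naturality, the enumeration of `a` maps the support of `ρ` onto the support of `σ`, which is
all of `a`. Since it is injective, the support of `ρ` must be full. -/
theorem extMem_of_mapTo (hD : IsFunctor D) (hU : IsSupport D U) (hσ : ObjMem D n σ)
    (ha : SuppTo U n σ a) {ρ : N} (hρ : MapTo D (inc n a) ρ σ) :
    ExtMem D U (fun _ => True) (fun x y => x < y) (pair a ρ) := by
  obtain ⟨h1, h2⟩ := hU.finSubset n σ a hσ ha
  have hA := incFun_en_of h2
  have hρ' := mapTo_dom hD hA hρ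
  obtain ⟨w, hw, -⟩ := hU.total _ ρ hρ'
  refine ⟨a, ρ, card a, w, rfl, h1, fun _ _ => trivial, (isCard_iff h1).2 rfl, hρ', hw,
    fun i => ⟨(hU.finSubset _ ρ w hρ' hw).2 i, fun hi => ?_⟩⟩
  obtain ⟨j, hj, hj'⟩ := (hU.natural _ _ _ _ _ _ _ hA.isMor hρ hw ha _).1 (finMem_en hi)
  rw [app_mor hA] at hj'
  rwa [hA.inj hi hj'.1 hj'.2]

end Extension

/-! ### Functions and sets of pairs -/

section Fun

variable {N : Type u} [Model N]

/-- The set of pairs that represents a function. -/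
def funSet (f : N → N) : Set N := {z | ∃ x, z = pair x (f x)}

@[simp] theorem pair_mem_funSet {f : N → N} {x y : N} : pair x y ∈ funSet f ↔ y = f x := by
  constructor
  · rintro ⟨x', h⟩
    obtain ⟨rfl, rfl⟩ := pair_inj.1 h
    rfl
  · rintro rfl
    exact ⟨x, rfl⟩

theorem isFun_funSet (f : N → N) : IsFun (funSet f) :=
  ⟨fun _ ⟨x, hx⟩ => ⟨x, f x, hx⟩, fun x => ⟨f x, by simp, fun y hy => by simpa using hy⟩⟩

theorem funSet_mem_sets {f : N → N} (hf : Def N f) : funSet f ∈ sets (N := N) := by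
  change graph N f ∈ _ at hf
  convert hf using 1
  ext z
  exact exists_congr fun x => eq_comm

theorem IsFun.exists_def {F : Set N} (hF : F ∈ sets (N := N)) (h : IsFun F) :
    ∃ f, Def N f ∧ ∀ x y, pair x y ∈ F ↔ y = f x := by
  obtain ⟨f, hf, hf'⟩ := Model.exists_def (P := fun x y : N => pair x y ∈ F)
    (by fun_prop (disch := assumption)) (fun x => (h.2 x).exists)
  exact ⟨f, hf, fun x y => ⟨fun hy => (h.2 x).unique hy (hf' x), fun hy => hy ▸ hf' x⟩⟩

theorem IsBase.exists_def {B : Set N} (hB : B ∈ sets (N := N)) (h : IsBase B) :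
    ∃ b, Def N b ∧ (∀ x y, pair x y ∈ B ↔ y = b x) ∧ ∀ i, b i ≤ b (i + 1) := by
  obtain ⟨b, hb, hb'⟩ := IsFun.exists_def hB h.1
  exact ⟨b, hb, hb', fun i => h.2.1 i (i + 1) _ _ (lt_succ_iff.2 le_rfl) ((hb' _ _).2 rfl)
    ((hb' _ _).2 rfl)⟩

end Fun

/-! ### Goodstein sequences -/

section Goodstein

variable {N : Type u} [Model N] {D : Set N} (hDS : D ∈ sets (N := N))
  (hD : IsGoodsteinDilator sets D)
include hDS hD

/-- The code of the inclusion of `{0,…,m-1}` into `{0,…,n-1}`. -/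
local notation "incl" => fun m n => mor m n fun i => i

theorem exists_goodsteinSeq {b : N → N} (hb : Def N b) (hmono : ∀ i, b i ≤ b (i + 1)) {k : N}
    (hk : ObjMem D (b 0) k) : ∃ g : N → N, Def N g ∧ g 0 = k ∧ (∀ i, ObjMem D (b i) (g i)) ∧
      ∀ i, (g i = 0 → g (i + 1) = 0) ∧
        (g i ≠ 0 → MapTo D (incl (b i) (b (i + 1))) (g i) (g (i + 1) + 1)) := by
  have hincl : ∀ i, IncFun (b i) (b (i + 1)) fun i => i := fun i => IncFun.id (hmono i)
  -- The step function is found by search. A predecessor exists because `D(c_i)` fixes 0 and so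
  -- sends a nonzero `x` to a nonzero value; pairs outside the domain get 0 as a default.
  obtain ⟨h, hh, hh'⟩ := exists_def (α := N × N) (P := fun p y => (p.2 = 0 → y = 0) ∧
      (p.2 ≠ 0 → ObjMem D (b p.1) p.2 → MapTo D (incl (b p.1) (b (p.1 + 1))) p.2 (y + 1)))
    (.and (.imp (by fun_prop) (by fun_prop)) (.imp (.not (by fun_prop)) (.imp
      (by fun_prop (disch := assumption))
      (.mapTo hDS (.mor (by fun_prop) (by fun_prop) (by fun_prop)) (by fun_prop) (by fun_prop)))))
    (by
      rintro ⟨i, x⟩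
      by_cases hx : x = 0
      · exact ⟨0, fun _ => rfl, fun h => absurd hx h⟩
      by_cases hx' : ObjMem D (b i) x
      · obtain ⟨τ, hτ⟩ := exists_mapTo hD.1 (hincl i) hx'
        have hpos := mapTo_lt hD (hincl i) (mapTo_zero hD (hincl i)) hτ (pos_iff_ne_zero.2 hx)
        obtain ⟨y, rfl⟩ := pos_iff_exists.1 hpos
        exact ⟨y, fun h => absurd h hx, fun _ _ => hτ⟩
      · exact ⟨0, fun _ => rfl, fun _ h => absurd h hx'⟩)
  obtain ⟨F, hF, hF0, hFs⟩ := exists_recursion (α := N) (g := fun _ => k)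
    (h := fun _ i x => h (i, x)) (by fun_prop) (by fun_prop)
  have hg : Def N (F 0) := hF.section_right 0
  have hobj : ∀ i, ObjMem D (b i) (F 0 i) := by
    refine def_induction (P := fun i => ObjMem D (b i) (F 0 i))
      (by fun_prop (disch := assumption)) (by rwa [hF0]) fun i ih => ?_
    obtain ⟨h1, h2⟩ := hh' (i, F 0 i)
    rw [hFs]
    by_cases hx : F 0 i = 0
    · rw [h1 hx]
      have h0 := IncFun.id (N := N) (zero_le : 0 ≤ b (i + 1))
      exact mapTo_cod hD.1 h0 (mapTo_zero hD h0)
    · exact hD.initial _ _ _ (mapTo_cod hD.1 (hincl i) (h2 hx ih)) (lt_succ_iff.2 le_rfl)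
  refine ⟨F 0, hg, hF0 0, hobj, fun i => ?_⟩
  rw [hFs]
  exact ⟨(hh' (i, F 0 i)).1, fun hx => (hh' (i, F 0 i)).2 hx (hobj i)⟩

theorem goodsteinTerminates_of_wellFounded (h : ExtNatWellFounded sets D) :
    GoodsteinTerminates sets D := by
  obtain ⟨U, hUS, hU, hwf⟩ := h
  intro B hBS hB u k hu hk
  obtain ⟨b, hb, hb', hmono⟩ := IsBase.exists_def hBS hB
  obtain rfl := (hb' _ _).1 hu
  have hincl : ∀ i, IncFun (b i) (b (i + 1)) fun i => i := fun i => IncFun.id (hmono i)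
  obtain ⟨g, hg, hg0, hobj, hgs⟩ := exists_goodsteinSeq hDS hD hb hmono hk
  refine ⟨funSet g, funSet_mem_sets hg, ⟨isFun_funSet g, by simp [hg0], ?_⟩, ?_⟩
  · simp only [pair_mem_funSet]
    rintro i _ _ rfl rfl
    exact ⟨(hgs i).1, fun hx => ⟨b i, b (i + 1), _, _, (hb' _ _).2 rfl, (hb' _ _).2 rfl,
      (hincl i).isMor, (isIncl_mor (hincl i)).2 fun _ _ => rfl, (hgs i).2 hx, rfl⟩⟩
  by_contra! hne
  simp only [pair_mem_funSet] at hne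
  -- Normal forms are chosen uniformly, so that the descending sequence is a set of the model.
  obtain ⟨a, ρ, ha, hρ, haρ⟩ := exists_def_pair (α := N)
    (P := fun i a ρ => SuppTo U (b i) (g i) a ∧ MapTo D (inc (b i) a) ρ (g i))
    (.and (by unfold SuppTo; fun_prop (disch := assumption)) (by fun_prop (disch := assumption)))
    (fun i => exists_extMem hU (hobj i))
  refine hwf ⟨funSet fun i => pair (a i) (ρ i), funSet_mem_sets (by fun_prop), isFun_funSet _, ?_, ?_⟩
  · simp only [pair_mem_funSet]
    rintro i _ rfl
    exact extMem_of_mapTo hD.1 hU (hobj i) (haρ i).1 (haρ i).2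
  · simp only [pair_mem_funSet]
    rintro i _ _ rfl rfl
    obtain ⟨h1, h2⟩ := hU.finSubset _ _ _ (hobj i) (haρ i).1
    obtain ⟨h1', h2'⟩ := hU.finSubset _ _ _ (hobj (i + 1)) (haρ (i + 1)).1
    have h3 : ∀ x, FinMem x (a i) → x < b (i + 1) := fun x hx => (h2 x hx).trans_le (hmono i)
    -- The comparison takes place in `D(b(i+1))`, where the normal form of `g i` has the value `g (i
    -- + 1) + 1`.
    refine (extLt_iff hD h1' h1 h2' h3 (haρ (i + 1)).2 (mapTo_comp hD.1 (incFun_en_of h2) (hincl i)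
      (incFun_en_of h3) (fun _ _ => rfl) (haρ i).2 ((hgs i).2 (fun h => hne i h.symm)))).2 ?_
    exact lt_succ_iff.2 le_rfl

theorem wellFounded_of_goodsteinTerminates (h : GoodsteinTerminates sets D) :
    ExtNatWellFounded sets D := by
  obtain ⟨U, hUS, hU⟩ := exists_isSupport hDS hD
  refine ⟨U, hUS, hU, ?_⟩
  rintro ⟨Z, hZS, hZ, hmem, hdesc⟩
  obtain ⟨z, hz, hz'⟩ := IsFun.exists_def hZS hZ
  obtain ⟨a, σ, ha, hσ, haσ⟩ := exists_def_pair (α := N) (P := fun i a σ => z i = pair a σ)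
    (by fun_prop) (fun i => by
      obtain ⟨a, σ, c, w, h, -⟩ := hmem i _ ((hz' _ _).2 rfl)
      exact ⟨a, σ, h⟩)
  have hfin : ∀ i, IsFinSet (a i) ∧ ObjMem D (card (a i)) (σ i) := fun i => by
    obtain ⟨a', σ', c, w, h, h1, -, h2, h3, -⟩ := hmem i _ ((hz' _ _).2 rfl)
    rw [haσ i, pair_inj] at h
    obtain ⟨rfl, rfl⟩ := h
    exact ⟨h1, (isCard_iff h1).1 h2 ▸ h3⟩
  -- Partial sums give a non-decreasing `b` with `z i < b i`. Elements of `a i` are smaller than its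
  -- code, hence than `z i`; the summand 1 also makes `b 0` positive.
  obtain ⟨b, hb, hb0, hbs⟩ : ∃ b : N → N, Def N b ∧ b 0 = z 0 + 1 ∧
      ∀ i, b (i + 1) = b i + (z (i + 1) + 1) := by
    obtain ⟨F, hF, hF0, hFs⟩ := exists_recursion (α := N) (g := fun _ => z 0 + 1)
      (h := fun _ i x => x + (z (i + 1) + 1)) (by fun_prop) (by fun_prop)
    exact ⟨F 0, hF.section_right 0, hF0 0, hFs 0⟩
  have hmono : ∀ i, b i ≤ b (i + 1) := fun i => by rw [hbs]; exact le_self_add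
  have hzb : ∀ i, z i < b i := by
    intro i
    rcases eq_zero_or_succ i with rfl | ⟨i, rfl⟩
    · rw [hb0]; exact lt_succ_iff.2 le_rfl
    · rw [hbs]; exact (lt_succ_iff.2 le_rfl).trans_le le_add_self
  have hincl : ∀ i, IncFun (b i) (b (i + 1)) fun i => i := fun i => IncFun.id (hmono i)
  have hab : ∀ i x, FinMem x (a i) → x < b i := fun i x hx =>
    (hx.lt.trans_le ((left_le_pair _ _).trans_eq (haσ i).symm)).trans (hzb i)
  have hA : ∀ i, IncFun (card (a i)) (b i) (en (a i)) := fun i => incFun_en_of (hab i)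
  obtain ⟨e, he, he'⟩ := exists_def (P := fun i x => MapTo D (inc (b i) (a i)) (σ i) x)
    (by fun_prop (disch := assumption)) (fun i => exists_mapTo hD.1 (hA i) (hfin i).2)
  have hstep : ∀ i x, MapTo D (incl (b i) (b (i + 1))) (e i) x → e (i + 1) < x := by
    intro i x hx
    have h3 : ∀ x, FinMem x (a i) → x < b (i + 1) := fun x hx => (hab i x hx).trans_le (hmono i)
    have := hdesc i _ _ ((hz' _ _).2 rfl) ((hz' _ _).2 rfl)
    rw [haσ i, haσ (i + 1)] at this
    exact (extLt_iff hD (hfin (i + 1)).1 (hfin i).1 (hab (i + 1)) h3 (he' (i + 1))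
      (mapTo_comp hD.1 (hA i) (hincl i) (incFun_en_of h3) (fun _ _ => rfl) (he' i) hx)).1 this
  -- If `e i` were 0, its image in the next stage would be 0, with `e (i + 1)` strictly below.
  have hpos : ∀ i, e i ≠ 0 := fun i h0 =>
    not_lt_zero (hstep i 0 (h0 ▸ mapTo_zero hD (hincl i)))
  have hbase : IsBase (funSet b) := by
    refine ⟨isFun_funSet b, ?_, ?_⟩
    · simp only [pair_mem_funSet]
      rintro i j _ _ hij rfl rfl
      refine le_iff_lt_or_eq.1 ?_
      refine def_induction (P := fun j => i ≤ j → b i ≤ b j) (.imp (by fun_prop) (by fun_prop))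
        ?_ ?_ j hij.le
      · intro h0
        rw [nonpos_iff_eq_zero.1 h0]
      · intro j ih hj
        rcases hj.lt_or_eq with hj | rfl
        · exact (ih (lt_succ_iff.1 hj)).trans (hmono j)
        · exact le_rfl
    · simp only [pair_mem_funSet]
      rintro _ rfl
      exact zero_le.trans_lt (hzb 0)
  obtain ⟨G, hGS, ⟨hGf, hG0, hGs⟩, i, hi⟩ := h _ (funSet_mem_sets hb) hbase (b 0) (e 0) (by simp)
    (mapTo_cod hD.1 (hA 0) (he' 0))
  obtain ⟨g, hg, hg'⟩ := IsFun.exists_def hGS hGf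
  -- By monotonicity, `e (i + 1) < D(c_i)(e i) ≤ D(c_i)(g i) = g (i + 1) + 1`, so the subtraction of
  -- one preserves domination. That `g i` is nonzero follows from the induction hypothesis.
  have hle : ∀ i, e i ≤ g i := by
    refine def_induction (P := fun i => e i ≤ g i) (by fun_prop) ((hg' _ _).1 hG0).le ?_
    intro i ih
    have hne : g i ≠ 0 := fun h0 => hpos i (nonpos_iff_eq_zero.1 (h0 ▸ ih))
    obtain ⟨u, v, c, τ, hu, hv, hc, hc', hτ, h⟩ :=
      (hGs i _ _ ((hg' _ _).2 rfl) ((hg' _ _).2 rfl)).2 hne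
    rw [pair_mem_funSet] at hu hv
    subst hu hv h
    -- The sequence supplies some code of the inclusion, which is identified with the canonical one.
    obtain ⟨C, hC, rfl⟩ := IsMor.exists_fun hc
    rw [isIncl_mor hC] at hc'
    rw [mor_congr hc'] at hτ
    obtain ⟨x, hx⟩ := exists_mapTo hD.1 (hincl i) (mapTo_cod hD.1 (hA i) (he' i))
    exact lt_succ_iff.1 ((hstep i x hx).trans_le (mapTo_le hD (hincl i) hx hτ ih))
  have := hle i
  rw [← (hg' _ _).1 hi] at this
  exact hpos i (nonpos_iff_eq_zero.1 this)

end Goodstein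
end Model
end SOA

theorem theorem2 {N : Type u} [SOA.NumStr N] (S : Set (Set N)) (hS : SOA.ModelsRCA0 S)
    (D : Set N) (hDS : D ∈ S) (hD : SOA.IsGoodsteinDilator S D) :
    SOA.GoodsteinTerminates S D ↔ SOA.ExtNatWellFounded S D := by
  let _ : SOA.Model N := { sets := S, models := hS }
  exact ⟨SOA.Model.wellFounded_of_goodsteinTerminates hDS hD,
    SOA.Model.goodsteinTerminates_of_wellFounded hDS hD⟩
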